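/- Setting. $\|\cdot\|$ is the infinity norm (on stacked vectors $(x,d)$ too). Let $\Xi=(X,U,D,f)$ be a discrete-time control system with compact $X\subseteq\mathbb R^n$, $D\subseteq\mathbb R^p$, finite $U\subset\mathbb R^{m}$ and an (unknown) map $f:X\times U\times D\to X$. Let $\hat\Xi=(\hat X,U,\hat D,\hat f)$ be a symbolic abstraction: $\hat X\subseteq X$, $\hat D\subseteq D$ are finite, $\hat f=\mathcal P\circ f$, and $\mathcal P:X\to\hat X$ satisfies $\|\mathcal P(x)-x\|\le\sigma$ on $X$. A function $\mathcal S:X\times\hat X\to\mathbb R_{\ge 0}$ is an alternating pseudo-bisimulation function (APBF) between $\hat\Xi$ and $\Xi$ if there are $\gamma>0$, $0<\mu<1$, $\eta,\theta\ge 0$ such that for all $x\in X,\hat x\in\hat X,\nu\in U,d\in D,\hat d\in\hat D$: $\gamma\|x-\hat x\|^2\le\mathcal S(x,\hat x)$ and $\mathcal S(f(x,\nu,d),\hat f(\hat x,\nu,\hat d))\le\max\{\mu\mathcal S(x,\hat x),\eta\|d-\hat d\|^2,\theta\}$. Scenario program. Fix basis functions $g_1,\dots,g_z$ (e.g. monomials),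 put $\mathcal S(\varphi,x,\hat x)=\sum_j\varphi_j g_j(x,\hat x)$, and fix $\tilde\mu_1,\dots,\tilde\mu_l\in(0,1)$, $l\ge1$. For $G=(\gamma,\tilde\eta,\tilde\theta,\varphi)$ with $\gamma>0$, $\tilde\eta,\tilde\theta\ge0$, $\varphi\in\mathbb R^z$ let $\mathcal H_1=\gamma\|x-\hat x\|^2-\mathcal S(\varphi,x,\hat x)$ and $\mathcal H_{2}=\mathcal S(\varphi,f(x,\nu,d),\hat f(\hat x,\nu,\hat d))-\tilde\mu_t\,\mathcal S(\varphi,x,\hat x)-\tilde\eta\|d-\hat d\|^2-\tilde\theta$. Let $C$ be a closed convex set of decision vectors $G$ (the whole space if no further constraints, such as bounds on the coefficients, are imposed). Given samples $(\bar x_i,\bar d_i)_{i=1}^{\mathcal Q}$, drawn i.i.d. from a probability distribution $\mathbb P$ on $X\times D$, the scenario program (SOP) minimizes $\xi$ over $t\in\{1,\dots,l\}$, admissible $G\in C$ and $\xi\in\mathbb R$ subject to $\max\{\mathcal H_1,\mathcal H_2\}\le\xi$ at $(\bar x_i,\bar d_i)$ for all $i$ and all $\hat x\in\hat X,\hat d\in\hat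 D,\nu\in U$. Assume that it has almost surely a solution with value $\xi^*_{\mathcal Q}$ and decision $G^*$, where several optimal $G$ for the same $\tilde\mu_t$ are told apart by minimizing a fixed strictly convex tie-break function (no condition if the optimal $G$ is unique); the data-driven candidate is $\mathcal S=\mathcal S(\varphi^*,\cdot,\cdot)$. Theorem. For each $t$ and each admissible $G\in C$ let $\mathcal H_1$ be Lipschitz in $x\in X$ with constant $\mathscr L_1$ and $\mathcal H_2$ (with $\tilde\mu_t$) Lipschitz in $(x,d)\in X\times D$ with constant $\mathscr L_{2_t}$, for all $\hat x,\nu,\hat d$ (the constants may depend on $G$); let $\mathscr L_{\mathcal H_t}=\max\{\mathscr L_1,\mathscr L_{2_t}\}$, taken at $G^*$. Let $\varkappa:\mathbb R_{\ge0}\to[0,1]$ satisfy $\varkappa(r)\le\mathbb P[\mathbb B_r(x,d)]$ for all $r\ge 0$ and $(x,d)\in X\times D$, with $\mathbb B_r$ the open ball. Let $\beta,\varepsilon_1,\dots,\varepsilon_l\in[0,1]$ and let $\varkappa^{-1}(\varepsilon_t)\ge0$ be a point that $\varkappa$ maps to $\varepsilon_t$. Let $\mathcal Q$ be the least natural number (or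 any larger one) with $$\sum_{t=1}^{l}\sum_{i=0}^{c-1}\binom{\mathcal Q}{i}\varepsilon_t^i(1-\varepsilon_t)^{\mathcal Q-i}\le\beta,$$ where $c=z+4$ is the number of real unknowns $\gamma,\tilde\eta,\tilde\theta,\varphi_1,\dots,\varphi_z,\xi$ of the SOP. Consider the criterion $$\xi^*_{\mathcal Q}+\max_t\mathscr L_{\mathcal H_t}\varkappa^{-1}(\varepsilon_t)\le0 .$$ Then the $\mathbb P^{\mathcal Q}$-probability that the criterion holds while $\mathcal S$ is not an APBF between $\hat\Xi$ and $\Xi$ is at most $\beta$. In particular, if the criterion holds (almost surely), then $\mathbb P^{\mathcal Q}\{\mathcal S\text{ is an APBF between }\hat\Xi\text{ and }\Xi\}\ge1-\beta$. -/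

import Mathlib

open MeasureTheory
open scoped NNReal

noncomputable section

/-- Vectors of dimension `k`; the norm on this type is the infinity norm. -/
abbrev Vec (k : ℕ) : Type := Fin k → ℝ

/-- A discrete-time nonlinear control system `(X, U, D, f)` with `X ⊆ ℝⁿ`, a finite input set
`U ⊆ ℝᵐ`, `D ⊆ ℝᵖ` and `f : X × U × D → X` (values of `f` off `X × U × D` play no role). -/
structure ControlSystem (n m p : ℕ) where
  X : Set (Vec n)
  U : Finset (Vec m)
  D : Set (Vec p)
  f : Vec n → Vec m → Vec p → Vec n
  f_mem : ∀ x ∈ X, ∀ ν ∈ U, ∀ d ∈ D, f x ν d ∈ X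

/-- The data of a symbolic abstraction of `Ξ`: finitely many representative states and disturbances,
and a quantization map `P : X → X̂` with state discretization parameter `σ`. -/
structure SymbolicAbstraction {n m p : ℕ} (Ξ : ControlSystem n m p) (σ : ℝ) where
  Xhat : Finset (Vec n)
  Dhat : Finset (Vec p)
  quant : Vec n → Vec n
  Xhat_subset : ∀ x ∈ Xhat, x ∈ Ξ.X
  Dhat_subset : ∀ d ∈ Dhat, d ∈ Ξ.D
  quant_mem : ∀ x ∈ Ξ.X, quant x ∈ Xhat
  quant_close : ∀ x ∈ Ξ.X, ‖quant x - x‖ ≤ σ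

/-- The transition map `f̂ = P ∘ f` of the symbolic abstraction. -/
def SymbolicAbstraction.fhat {n m p : ℕ} {Ξ : ControlSystem n m p} {σ : ℝ}
    (A : SymbolicAbstraction Ξ σ) (xh : Vec n) (ν : Vec m) (dh : Vec p) : Vec n :=
  A.quant (Ξ.f xh ν dh)

/-- `S` is an alternating pseudo-bisimulation function between the abstraction `A` and `Ξ`. -/
def IsAPBF {n m p : ℕ} {Ξ : ControlSystem n m p} {σ : ℝ} (A : SymbolicAbstraction Ξ σ)
    (S : Vec n → Vec n → ℝ) : Prop :=
  (∀ x ∈ Ξ.X, ∀ xh ∈ A.Xhat, 0 ≤ S x xh) ∧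
  ∃ γ μ η θ : ℝ, 0 < γ ∧ 0 < μ ∧ μ < 1 ∧ 0 ≤ η ∧ 0 ≤ θ ∧
    (∀ x ∈ Ξ.X, ∀ xh ∈ A.Xhat, γ * ‖x - xh‖ ^ 2 ≤ S x xh) ∧
    (∀ x ∈ Ξ.X, ∀ xh ∈ A.Xhat, ∀ ν ∈ Ξ.U, ∀ d ∈ Ξ.D, ∀ dh ∈ A.Dhat,
      S (Ξ.f x ν d) (A.fhat xh ν dh) ≤ max (μ * S x xh) (max (η * ‖d - dh‖ ^ 2) θ))

/-- The real decision variables `(γ, η̃, θ̃, φ)` of the optimization programs, with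
`φ ∈ ℝᶻ`. (The epigraph variable `ξ` is kept apart, and `μ̃` ranges over a finite set.) -/
abbrev Decision (z : ℕ) : Type := ℝ × ℝ × ℝ × (Fin z → ℝ)

namespace Decision

def γ {z : ℕ} (G : Decision z) : ℝ := G.1
def η {z : ℕ} (G : Decision z) : ℝ := G.2.1
def θ {z : ℕ} (G : Decision z) : ℝ := G.2.2.1
def φ {z : ℕ} (G : Decision z) : Fin z → ℝ := G.2.2.2

/-- The sign constraints `γ > 0`, `η̃ ≥ 0`, `θ̃ ≥ 0`. -/
def Admissible {z : ℕ} (G : Decision z) : Prop := 0 < G.γ ∧ 0 ≤ G.η ∧ 0 ≤ G.θ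

end Decision

/-- The candidate `S(φ, x, x̂) = ∑ⱼ φⱼ gⱼ(x, x̂)` for basis functions `g`. -/
def candidate {n z : ℕ} (g : Fin z → Vec n → Vec n → ℝ) (φ : Fin z → ℝ) (x xh : Vec n) : ℝ :=
  ∑ j, φ j * g j x xh

/-- `H₁ = γ ‖x - x̂‖² - S(φ, x, x̂)`. -/
def H1 {n z : ℕ} (g : Fin z → Vec n → Vec n → ℝ) (G : Decision z) (x xh : Vec n) : ℝ :=
  G.γ * ‖x - xh‖ ^ 2 - candidate g G.φ x xh

/-- `H₂ = S(φ, f(x,ν,d), f̂(x̂,ν,d̂)) - μ̃ S(φ, x, x̂) - η̃ ‖d - d̂‖² - θ̃`. -/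
def H2 {n m p z : ℕ} {Ξ : ControlSystem n m p} {σ : ℝ} (A : SymbolicAbstraction Ξ σ)
    (g : Fin z → Vec n → Vec n → ℝ) (μ : ℝ) (G : Decision z)
    (x xh : Vec n) (ν : Vec m) (d dh : Vec p) : ℝ :=
  candidate g G.φ (Ξ.f x ν d) (A.fhat xh ν dh) - μ * candidate g G.φ x xh
    - G.η * ‖d - dh‖ ^ 2 - G.θ

/-- Feasibility of `(G, ξ)` for the scenario program with samples `ω`, the value `μ` of `μ̃`, and the
decision variables `G` restricted to the set `C`. -/
def SOPFeasible {n m p z Q : ℕ} {Ξ : ControlSystem n m p} {σ : ℝ} (A : SymbolicAbstraction Ξ σ)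
    (g : Fin z → Vec n → Vec n → ℝ) (C : Set (Decision z)) (ω : Fin Q → Vec n × Vec p)
    (μ : ℝ) (G : Decision z) (ξ : ℝ) : Prop :=
  G.Admissible ∧ G ∈ C ∧
    ∀ i, ∀ xh ∈ A.Xhat, ∀ dh ∈ A.Dhat, ∀ ν ∈ Ξ.U,
      max (H1 g G (ω i).1 xh) (H2 A g μ G (ω i).1 xh ν (ω i).2 dh) ≤ ξ

/-- `(μ̃_t, G, ξ)` is the solution of the scenario program in which `μ̃` ranges over the finite family
`μ`: it is feasible, no feasible point has a smaller value `ξ`, and, should there be several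
optimal `G` for `μ̃_t`, it is the one that minimizes the tie-break function `τ`. -/
def IsSOPSolution {n m p z Q l : ℕ} {Ξ : ControlSystem n m p} {σ : ℝ}
    (A : SymbolicAbstraction Ξ σ) (g : Fin z → Vec n → Vec n → ℝ) (C : Set (Decision z))
    (τ : Decision z → ℝ) (μ : Fin l → ℝ) (ω : Fin Q → Vec n × Vec p)
    (t : Fin l) (G : Decision z) (ξ : ℝ) : Prop :=
  SOPFeasible A g C ω (μ t) G ξ ∧
  (∀ t' G' ξ', SOPFeasible A g C ω (μ t') G' ξ' → ξ ≤ ξ') ∧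
  (∀ G', SOPFeasible A g C ω (μ t) G' ξ → τ G ≤ τ G')

/-- The sample sizes `N` with `∑ₜ ∑_{i<c} (N choose i) εₜⁱ (1-εₜ)^{N-i} ≤ β`. -/
def sampleSizes {l : ℕ} (c : ℕ) (ε : Fin l → ℝ) (β : ℝ) : Set ℕ :=
  {N | ∑ t, ∑ i ∈ Finset.range c, (N.choose i : ℝ) * ε t ^ i * (1 - ε t) ^ (N - i) ≤ β}

end

/-!
The proof has a deterministic and a probabilistic part.

*Deterministic part.* Every ball of radius `r_t` around a point of `X × D` has probability at least
`ε_t`. If the constraints at the optimal decision are violated with probability less than `ε_t`, then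
each of these balls contains a point of `X × D` that satisfies them. The Lipschitz bounds turn the
criterion into `H₁ ≤ 0` and `H₂ ≤ 0` on all of `X × D`, which makes the candidate an APBF
(`isAPBF_of_violation_lt`, `isAPBF_of_nonpos`).

*Probabilistic part.* For each fixed `μ̃_t` the scenario program is convex in the `c = z + 4` unknowns,
and the probability that the violation probability of its solution is at least `ε` is at most the
binomial tail `∑_{i<c} (Q choose i) εⁱ (1 - ε)^{Q-i}` (`measure_isLexSolution_le`). The union bound
over `t` and the monotonicity of the tail in `Q` give the claim.

The scenario bound is derived from a counting problem. Among `n` constraints, of which each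
`N`-element set `R` determines a solution, count the sets `R` whose solution is violated by at least
`k` of the others. In a nondegenerate problem, in which the at most `c` essential constraints of `R`
already determine its solution, fill up the essential constraints to exactly `c` in a canonical way.
Then each `R` selects one `c`-element subset `B`, and `B` is selected by precisely the sets between
`B` and the complement of a forbidden set `W B`, which contains the violators (`Selects`). Counting
all `R` gives `∑_B (n - c - |W B| choose N - c) = (n choose N)` for every `N ≥ c`. These
identities determine the distribution of `|W B|`, so it is that of the example in which each set
selects its `c` smallest elements, and this bounds the count by a hypergeometric sum
(`IsNondegenerateLPType.card_le`).

Minimizing the maximum of strictly convex functions over a compact set is a nondegenerate problem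
once no function outside `R` is active at the minimizer for `R`; the bound on the number of essential
constraints is Helly's theorem. Adding small generic constants to the functions achieves this and
keeps all violations, so the counting bound holds for all strictly convex families
(`IsConvexFamily.card_le`). By exchangeability it bounds the probability that the solution for `N`
samples has many violators among `M` further samples; as `M → ∞` the law of large numbers and the
convergence of the hypergeometric to the binomial distribution give the bound on the violation
probability (`measure_lt_violationSet_le`). The program at hand, in which neither strict convexity
nor compactness nor the existence of a solution for every `t` is available, is approximated by adding
a small multiple of the tie-break function and by exhausting the domain with compact sets.
-/

namespace ScenarioBound

section Combinatorics

/-! ### Counting samples by their number of violators -/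

open Finset

/-- `Selects d W` says that every finite set `R` with at least `d` elements has exactly one
`d`-element subset `B` for which `R` avoids the forbidden set `W B`. The sets `R` that select `B` are
thus those between `B` and the complement of `W B`. -/
def Selects {H : Type*} (d : ℕ) (W : Finset H → Finset H) : Prop :=
  ∀ R : Finset H, d ≤ #R → ∃! B : Finset H, B ⊆ R ∧ #B = d ∧ Disjoint R (W B)

section Selects

variable {H : Type*} {d : ℕ} {W : Finset H → Finset H}

lemma Selects.disjoint (hW : Selects d W) {B : Finset H} (hB : #B = d) : Disjoint B (W B) := by
  obtain ⟨B', ⟨h1, h2, h3⟩, -⟩ := hW B hB.ge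
  obtain rfl : B' = B := eq_of_subset_of_card_le h1 (by omega)
  exact h3

variable [Fintype H] [DecidableEq H]

lemma card_filter_between {B V : Finset H} (hB : #B = d) (hBV : Disjoint B V) {N : ℕ}
    (hN : d ≤ N) :
    #{R ∈ powersetCard N (univ : Finset H) | B ⊆ R ∧ Disjoint R V} =
      (Fintype.card H - d - #V).choose (N - d) := by
  have hcard : #(univ \ (B ∪ V)) = Fintype.card H - d - #V := by
    rw [card_sdiff_of_subset (subset_univ _), card_union_of_disjoint hBV, hB, card_univ]
    omega
  rw [← hcard, ← card_powersetCard]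
  refine card_nbij' (fun R => R \ B) (fun T => B ∪ T) ?_ ?_ ?_ ?_
  · intro R hR
    simp only [coe_filter, mem_powersetCard, Set.mem_ofPred_eq, subset_univ, true_and] at hR
    obtain ⟨h1, h2, h3⟩ := hR
    simp only [mem_coe, mem_powersetCard]
    refine ⟨fun x hx => ?_, by rw [card_sdiff_of_subset h2, h1, hB]⟩
    have := disjoint_left.1 h3
    simp only [mem_sdiff, mem_univ, mem_union, true_and] at hx ⊢
    have := this hx.1
    tauto
  · intro T hT
    simp only [mem_coe, mem_powersetCard] at hT
    have hBT : Disjoint B T := by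
      refine disjoint_left.2 fun x hx hxT => ?_
      have := hT.1 hxT
      simp only [mem_sdiff, mem_union] at this
      tauto
    simp only [coe_filter, mem_powersetCard, Set.mem_ofPred_eq, subset_univ, true_and]
    refine ⟨by rw [card_union_of_disjoint hBT, hT.2, hB]; omega, subset_union_left, ?_⟩
    refine disjoint_union_left.2 ⟨hBV, disjoint_left.2 fun x hx hxV => ?_⟩
    have := hT.1 hx
    simp only [mem_sdiff, mem_union] at this
    tauto
  · intro R hR
    simp only [coe_filter, mem_powersetCard, Set.mem_ofPred_eq, subset_univ, true_and] at hR
    exact union_sdiff_of_subset hR.2.1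
  · intro T hT
    simp only [mem_coe, mem_powersetCard] at hT
    have hBT : Disjoint B T := by
      refine disjoint_left.2 fun x hx hxT => ?_
      have := hT.1 hxT
      simp only [mem_sdiff, mem_union] at this
      tauto
    exact union_sdiff_cancel_left hBT

/-- The `N`-element sets are counted according to the `d`-element set that they select. -/
lemma Selects.card_eq_sum (hW : Selects d W) {N : ℕ} (hN : d ≤ N)
    (p : Finset H → Prop) [DecidablePred p] :
    #{R ∈ powersetCard N (univ : Finset H) |
        ∃ B : Finset H, B ⊆ R ∧ #B = d ∧ Disjoint R (W B) ∧ p B} =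
      ∑ B ∈ powersetCard d (univ : Finset H) with p B,
        (Fintype.card H - d - #(W B)).choose (N - d) := by
  have : ({R ∈ powersetCard N (univ : Finset H) |
        ∃ B : Finset H, B ⊆ R ∧ #B = d ∧ Disjoint R (W B) ∧ p B} : Finset (Finset H)) =
      ({B ∈ powersetCard d (univ : Finset H) | p B}).biUnion fun B =>
        {R ∈ powersetCard N (univ : Finset H) | B ⊆ R ∧ Disjoint R (W B)} := by
    ext R
    simp only [mem_filter, mem_powersetCard, subset_univ, true_and, mem_biUnion]
    constructor
    · rintro ⟨h, B, h1, h2, h3, h4⟩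
      exact ⟨B, ⟨h2, h4⟩, h, h1, h3⟩
    · rintro ⟨B, ⟨h2, h4⟩, h, h1, h3⟩
      exact ⟨h, B, h1, h2, h3, h4⟩
  rw [this, card_biUnion]
  · refine sum_congr rfl fun B hB => ?_
    simp only [mem_filter, mem_powersetCard, subset_univ, true_and] at hB
    exact card_filter_between hB.1 (hW.disjoint hB.1) hN
  · intro B hB B' hB' hne
    simp only [mem_filter, mem_powersetCard, subset_univ, true_and, mem_coe] at hB hB'
    refine disjoint_left.2 fun R hR hR' => hne ?_
    simp only [mem_filter, mem_powersetCard, subset_univ, true_and] at hR hR'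
    exact (hW R (by omega)).unique ⟨hR.2.1, hB.1, hR.2.2⟩ ⟨hR'.2.1, hB'.1, hR'.2.2⟩

lemma Selects.sum_choose (hW : Selects d W) (m : ℕ) :
    ∑ B ∈ powersetCard d (univ : Finset H), (Fintype.card H - d - #(W B)).choose m =
      (Fintype.card H).choose (m + d) := by
  have h := hW.card_eq_sum (N := m + d) (by omega) (fun _ => True)
  simp only [filter_true, Nat.add_sub_cancel] at h
  rw [← h, ← card_univ (α := H), ← card_powersetCard]
  congr 1
  refine filter_true_of_mem fun R hR => ?_
  obtain ⟨B, hB, -⟩ := hW R (by rw [(mem_powersetCard.1 hR).2]; omega)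
  exact ⟨B, hB.1, hB.2.1, hB.2.2, trivial⟩

lemma Selects.card_add_card_le (hW : Selects d W) {B : Finset H} (hB : #B = d) :
    d + #(W B) ≤ Fintype.card H := by
  rw [← hB, ← card_union_of_disjoint (hW.disjoint hB)]
  exact card_le_univ _

end Selects

lemma coeff_sum_X_add_one_pow {α : Type*} (s : Finset α) (f : α → ℕ) (m : ℕ) :
    (∑ x ∈ s, (Polynomial.X + 1 : Polynomial ℤ) ^ f x).coeff m =
      ((∑ x ∈ s, (f x).choose m : ℕ) : ℤ) := by
  simp [Polynomial.finsetSum_coeff, Polynomial.coeff_X_add_one_pow]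

/-- The binomial sums `∑ₓ (f x choose m)`, for all `m`, determine how often `f` takes each value:
they are the coefficients of `∑ₓ (X + 1) ^ f x`. -/
lemma sum_comp_eq_of_sum_choose_eq {α β M : Type*} [AddCommMonoid M] (s : Finset α) (t : Finset β)
    (f : α → ℕ) (g : β → ℕ) (h : ∀ m, ∑ x ∈ s, (f x).choose m = ∑ y ∈ t, (g y).choose m)
    (F : ℕ → M) : ∑ x ∈ s, F (f x) = ∑ y ∈ t, F (g y) := by
  have hpoly : (∑ x ∈ s, (Polynomial.X + 1 : Polynomial ℤ) ^ f x) =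
      ∑ y ∈ t, (Polynomial.X + 1 : Polynomial ℤ) ^ g y := by
    ext m
    rw [coeff_sum_X_add_one_pow, coeff_sum_X_add_one_pow, h m]
  have hpoly' : (∑ x ∈ s, (Polynomial.X : Polynomial ℤ) ^ f x) =
      ∑ y ∈ t, (Polynomial.X : Polynomial ℤ) ^ g y := by
    have := congrArg (fun q : Polynomial ℤ => q.comp (Polynomial.X - 1)) hpoly
    simpa [Polynomial.sum_comp] using this
  have hcount : ∀ j, #{x ∈ s | f x = j} = #{y ∈ t | g y = j} := by
    intro j
    have := congrArg (fun q : Polynomial ℤ => q.coeff j) hpoly'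
    simp only [Polynomial.finsetSum_coeff, Polynomial.coeff_X_pow, sum_boole] at this
    simpa [eq_comm] using this
  have hmul : s.val.map f = t.val.map g := by
    ext j
    have h1 := hcount j
    rw [Multiset.count_map, Multiset.count_map]
    simpa [Finset.card, Finset.filter, eq_comm] using h1
  calc ∑ x ∈ s, F (f x) = ((s.val.map f).map F).sum := by rw [Multiset.map_map]; rfl
    _ = ∑ y ∈ t, F (g y) := by rw [hmul, Multiset.map_map]; rfl

/-- How often the forbidden set of the selected subset has at least `k` elements depends only on the
size of the ground set. -/
lemma Selects.card_eq_card {H H' : Type*} [Fintype H] [DecidableEq H] [Fintype H'] [DecidableEq H']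
    {d : ℕ} {W : Finset H → Finset H} {W' : Finset H' → Finset H'} (hW : Selects d W)
    (hW' : Selects d W') (hcard : Fintype.card H = Fintype.card H') {N : ℕ} (hN : d ≤ N) (k : ℕ) :
    #{R ∈ powersetCard N (univ : Finset H) |
        ∃ B : Finset H, B ⊆ R ∧ #B = d ∧ Disjoint R (W B) ∧ k ≤ #(W B)} =
      #{R ∈ powersetCard N (univ : Finset H') |
        ∃ B : Finset H', B ⊆ R ∧ #B = d ∧ Disjoint R (W' B) ∧ k ≤ #(W' B)} := by
  rw [hW.card_eq_sum hN, hW'.card_eq_sum hN, sum_filter, sum_filter]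
  have := sum_comp_eq_of_sum_choose_eq (powersetCard d (univ : Finset H))
    (powersetCard d (univ : Finset H')) (fun B => Fintype.card H - d - #(W B))
    (fun B => Fintype.card H' - d - #(W' B))
    (fun m => by rw [hW.sum_choose, hW'.sum_choose, hcard])
    (fun e => if k + e ≤ Fintype.card H - d then e.choose (N - d) else 0)
  convert this using 1
  · refine sum_congr rfl fun B hB => ?_
    have := hW.card_add_card_le (mem_powersetCard.1 hB).2
    congr 1
    rw [eq_iff_iff]
    omega
  · refine sum_congr rfl fun B hB => ?_
    have := hW'.card_add_card_le (mem_powersetCard.1 hB).2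
    congr 1
    rw [eq_iff_iff]
    omega

/-- A finite set of size at least `m` has an initial segment of size `m` for the order of the
keys `κ`. -/
lemma exists_initial_segment {H : Type*} [DecidableEq H] {κ : H → ℕ} (hκ : Function.Injective κ)
    (A : Finset H) {m : ℕ} (hm : m ≤ #A) :
    ∃ T ⊆ A, #T = m ∧ ∀ p ∈ T, ∀ q ∈ A, q ∉ T → κ p < κ q := by
  induction m with
  | zero => exact ⟨∅, by simp, rfl, by simp⟩
  | succ m ih =>
    obtain ⟨T, hTA, hT, hlt⟩ := ih (by omega)
    have hne : (A \ T).Nonempty := by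
      rw [← card_pos, card_sdiff_of_subset hTA]
      omega
    obtain ⟨a, ha, hmin⟩ := exists_min_image (A \ T) κ hne
    rw [mem_sdiff] at ha
    refine ⟨insert a T, insert_subset ha.1 hTA, by rw [card_insert_of_notMem ha.2, hT], ?_⟩
    intro p hp q hq hqT
    rw [mem_insert, not_or] at hqT
    rcases mem_insert.1 hp with rfl | hp
    · exact lt_of_le_of_ne (hmin q (mem_sdiff.2 ⟨hq, hqT.2⟩)) fun h => hqT.1 (hκ h).symm
    · exact hlt p hp q hq hqT.2

section LPType

variable {H α : Type*} [DecidableEq H] [LinearOrder α]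

/-- The elements of `R` whose removal changes the value of `v`. -/
def essential (v : Finset H → α) (R : Finset H) : Finset H := {s ∈ R | v (R.erase s) ≠ v R}

/-- The elements whose addition to `R` changes the value of `v`. -/
def violators [Fintype H] (v : Finset H → α) (R : Finset H) : Finset H :=
  {s | v (insert s R) ≠ v R}

/-- The elements outside `R` with a smaller key than some inessential element of `R`. -/
def undercutters [Fintype H] (v : Finset H → α) (κ : H → ℕ) (R : Finset H) : Finset H :=
  {q | q ∉ R ∧ ∃ p ∈ R \ essential v R, κ q < κ p}

/-- A nondegenerate problem of LP type and combinatorial dimension at most `d`: the value `v R` of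
the constraint set `R` is monotone in `R`; if `R ⊆ R'` have the same value, then a constraint that
does not change the value of `R` does not change that of `R'`; and the essential constraints of `R`,
at most `d` in number, already determine its value. -/
structure IsNondegenerateLPType (d : ℕ) (v : Finset H → α) : Prop where
  mono : Monotone v
  locality : ∀ ⦃R R' : Finset H⦄, R ⊆ R' → v R = v R' → ∀ s, v (insert s R) = v R →
    v (insert s R') = v R'
  value_essential : ∀ R, v (essential v R) = v R
  card_essential : ∀ R, #(essential v R) ≤ d

namespace IsNondegenerateLPType

variable {d : ℕ} {v : Finset H → α} (hv : IsNondegenerateLPType d v)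
include hv

lemma union_eq {B T : Finset H} (h : ∀ s ∈ T, v (insert s B) = v B) : v (B ∪ T) = v B := by
  induction T using Finset.induction_on with
  | empty => simp
  | insert s T _ ih =>
    have ih' := ih fun t ht => h t (mem_insert_of_mem ht)
    rw [union_insert, hv.locality subset_union_left ih'.symm s (h s (mem_insert_self _ _)), ih']

lemma essential_subset_of_eq {B R : Finset H} (hBR : B ⊆ R) (h : v B = v R) :
    essential v R ⊆ B := by
  intro s hs
  by_contra hsB
  obtain ⟨-, hs⟩ := mem_filter.1 hs
  refine hs (le_antisymm (hv.mono (erase_subset _ _)) ?_)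
  rw [← h]
  exact hv.mono fun x hx => mem_erase.2 ⟨fun hxs => hsB (hxs ▸ hx), hBR hx⟩

lemma essential_eq {B R : Finset H} (hBR : B ⊆ R) (h : v B = v R) :
    essential v B = essential v R := by
  have hsub := hv.essential_subset_of_eq hBR h
  refine Subset.antisymm ?_ fun s hs => mem_filter.2 ⟨hsub hs, fun hB => ?_⟩
  · exact hv.essential_subset_of_eq hsub ((hv.value_essential R).trans h.symm)
  · refine (mem_filter.1 hs).2 (le_antisymm (hv.mono (erase_subset _ _)) ?_)
    rw [← h, ← hB]
    exact hv.mono (erase_subset_erase _ hBR)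

variable [Fintype H]

/-- In a nondegenerate problem each large enough `R` selects its essential constraints, filled up to
`d` elements with the remaining ones of smallest key. A set with the same value but another filling
is recognized by a further element of smaller key. -/
lemma selects {κ : H → ℕ} (hκ : Function.Injective κ) :
    Selects d fun B => violators v B ∪ undercutters v κ B := by
  intro R hR
  have hER : essential v R ⊆ R := filter_subset _ _
  obtain ⟨T, hTR, hT, hlt⟩ := exists_initial_segment hκ (R \ essential v R)
    (m := d - #(essential v R)) (by rw [card_sdiff_of_subset hER]; omega)
  have hdisj : Disjoint (essential v R) T :=
    disjoint_left.2 fun x hx hxT => (mem_sdiff.1 (hTR hxT)).2 hx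
  have hBR : essential v R ∪ T ⊆ R := union_subset hER (hTR.trans sdiff_subset)
  have hval : v (essential v R ∪ T) = v R :=
    le_antisymm (hv.mono hBR) ((hv.value_essential R).symm.trans_le (hv.mono subset_union_left))
  refine ⟨essential v R ∪ T, ⟨hBR, ?_, ?_⟩, ?_⟩
  · rw [card_union_of_disjoint hdisj, hT]
    have := hv.card_essential R
    omega
  · beta_reduce
    refine disjoint_left.2 fun x hx hxW => ?_
    simp only [mem_union, violators, undercutters, mem_filter, mem_univ, true_and, mem_sdiff,
      hv.essential_eq hBR hval] at hxW
    rcases hxW with hxW | ⟨hxB, p, ⟨hpB, hpE⟩, hlt'⟩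
    · refine hxW (le_antisymm ?_ (hv.mono (subset_insert _ _)))
      rw [hval]
      exact hv.mono (insert_subset hx hBR)
    · rw [not_or] at hxB
      have := hlt p (hpB.resolve_left hpE) x (mem_sdiff.2 ⟨hx, hxB.1⟩) hxB.2
      omega
  · -- Two selected sets have the same essential part; comparing keys, so are their fillings.
    have hstep : ∀ B : Finset H, B ⊆ R → Disjoint R
        (violators v B ∪ undercutters v κ B) →
        essential v B = essential v R ∧
          ∀ q ∈ R, q ∉ B → ∀ p ∈ B, p ∉ essential v R → κ p ≤ κ q := by
      intro B hB hBd
      have hvB : v B = v R := by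
        rw [← union_eq_right.2 hB, hv.union_eq]
        intro s hs
        by_contra hne
        exact disjoint_left.1 hBd hs (mem_union_left _ (by simpa [violators] using hne))
      have hE := hv.essential_eq hB hvB
      refine ⟨hE, fun q hq hqB p hp hpE => ?_⟩
      by_contra hlt'
      refine disjoint_left.1 hBd hq (mem_union_right _ ?_)
      simp only [undercutters, mem_filter, mem_univ, true_and, mem_sdiff]
      exact ⟨hqB, p, ⟨hp, hE ▸ hpE⟩, by omega⟩
    have huniq : ∀ B B' : Finset H, B ⊆ R → B' ⊆ R → #B = d → #B' = d →
        (essential v B = essential v R ∧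
          ∀ q ∈ R, q ∉ B → ∀ p ∈ B, p ∉ essential v R → κ p ≤ κ q) →
        (essential v B' = essential v R ∧
          ∀ q ∈ R, q ∉ B' → ∀ p ∈ B', p ∉ essential v R → κ p ≤ κ q) → B = B' := by
      rintro B B' hB hB' hBd hBd' ⟨h1, h2⟩ ⟨h3, h4⟩
      by_contra hne
      have hsub : essential v R ⊆ B := h1 ▸ filter_subset _ _
      have hsub' : essential v R ⊆ B' := h3 ▸ filter_subset _ _
      obtain ⟨p, hp, hpB'⟩ := not_subset.1 fun h : B ⊆ B' =>
        hne (eq_of_subset_of_card_le h (by omega))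
      obtain ⟨q, hq, hqB⟩ := not_subset.1 fun h : B' ⊆ B =>
        hne (eq_of_subset_of_card_le h (by omega)).symm
      have hpq := h2 q (hB' hq) hqB p hp fun h => hpB' (hsub' h)
      have hqp := h4 p (hB hp) hpB' q hq fun h => hqB (hsub h)
      exact hpB' (hκ (le_antisymm hpq hqp) ▸ hq)
    rintro B ⟨hB, hBd, hBW⟩
    refine huniq B _ hB hBR hBd ?_ (hstep B hB hBW) ⟨hv.essential_eq hBR hval, ?_⟩
    · rw [card_union_of_disjoint hdisj, hT]
      have := hv.card_essential R
      omega
    · intro q hq hqB p hp hpE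
      rw [mem_union, not_or] at hqB
      exact (hlt p ((mem_union.1 hp).resolve_left hpE) q (mem_sdiff.2 ⟨hq, hqB.1⟩) hqB.2).le

end IsNondegenerateLPType

end LPType

/-- The extremal example: a set selects its `d` smallest elements. -/
lemma selects_smallest (n d : ℕ) :
    Selects d (fun B : Finset (Fin n) => ({q | q ∉ B ∧ ∃ p ∈ B, q < p} : Finset (Fin n))) := by
  have hv : IsNondegenerateLPType d (fun _ : Finset (Fin n) => (0 : ℕ)) :=
    ⟨fun _ _ _ => le_rfl, fun _ _ _ _ _ _ => rfl, fun _ => rfl, fun _ => by simp [essential]⟩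
  have := hv.selects Fin.val_injective
  simpa [violators, undercutters, essential] using this

lemma card_filter_inter_lt_le {H : Type*} [Fintype H] [DecidableEq H] (A : Finset H) (N d : ℕ) :
    #{R ∈ powersetCard N (univ : Finset H) | #(R ∩ A) < d} ≤
      ∑ i ∈ range d, (#A).choose i * (Fintype.card H - #A).choose (N - i) := by
  have hmap : Set.MapsTo (fun R : Finset H => #(R ∩ A))
      ({R ∈ powersetCard N (univ : Finset H) | #(R ∩ A) < d} : Finset (Finset H)) (range d) := by
    intro R hR
    simpa using (mem_filter.1 hR).2
  rw [card_eq_sum_card_fiberwise hmap]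
  refine sum_le_sum fun i _ => ?_
  rw [← card_univ, ← card_sdiff_of_subset (subset_univ A), ← card_powersetCard i A,
    ← card_powersetCard (N - i) (univ \ A), ← card_product]
  refine card_le_card_of_injOn (fun R => (R ∩ A, R \ A)) ?_ ?_
  · intro R hR
    simp only [coe_filter, mem_filter, mem_powersetCard, subset_univ, true_and,
      Set.mem_ofPred_eq] at hR
    simp only [coe_product, Set.mem_prod, mem_coe, mem_powersetCard]
    refine ⟨⟨inter_subset_right, hR.2⟩, sdiff_subset_sdiff (subset_univ _) Subset.rfl, ?_⟩
    have := card_sdiff_add_card_inter R A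
    omega
  · intro R _ R' _ h
    simp only [Prod.mk.injEq] at h
    rw [← sdiff_union_inter R A, ← sdiff_union_inter R' A, h.1, h.2]

/-- In a nondegenerate problem of dimension at most `d`, the sets of `N` constraints that have at
least `k` violators are at most as many as the `N`-element sets that meet a fixed set of
`k + d - 1` elements in fewer than `d` elements. -/
theorem IsNondegenerateLPType.card_le {H α : Type*} [Fintype H] [DecidableEq H] [LinearOrder α]
    {d : ℕ} {v : Finset H → α} (hv : IsNondegenerateLPType d v) (hd : 1 ≤ d) {N k : ℕ}
    (hN : d ≤ N) (hk : k + d - 1 ≤ Fintype.card H) :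
    #{R ∈ powersetCard N (univ : Finset H) | k ≤ #(violators v R)} ≤
      ∑ i ∈ range d,
        (k + d - 1).choose i * (Fintype.card H - (k + d - 1)).choose (N - i) := by
  obtain ⟨n, hn⟩ : ∃ n, n = Fintype.card H := ⟨_, rfl⟩
  rw [← hn] at hk ⊢
  obtain ⟨e⟩ : Nonempty (H ≃ Fin n) := ⟨Fintype.equivFinOfCardEq hn.symm⟩
  have hsel := hv.selects (κ := fun s => (e s).val) (Fin.val_injective.comp e.injective)
  calc _ ≤ _ := card_le_card (t := {R ∈ powersetCard N (univ : Finset H) |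
            ∃ B : Finset H, B ⊆ R ∧ #B = d ∧ Disjoint R (violators v B ∪
              undercutters v (fun s => (e s).val) B) ∧
              k ≤ #(violators v B ∪
                undercutters v (fun s => (e s).val) B)}) ?_
    _ = _ := hsel.card_eq_card (selects_smallest n d) (by simp [← hn]) hN k
    _ ≤ #{R ∈ powersetCard N (univ : Finset (Fin n)) |
          #(R ∩ ({i | i.val < k + d - 1} : Finset (Fin n))) < d} := card_le_card ?_
    _ ≤ _ := by
      have hA : #({i | i.val < k + d - 1} : Finset (Fin n)) = k + d - 1 := by
        rw [Fin.card_filter_val_lt]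
        omega
      refine (card_filter_inter_lt_le _ N d).trans_eq ?_
      rw [hA, Fintype.card_fin]
  · intro R hR
    obtain ⟨hR, hkR⟩ := mem_filter.1 hR
    refine mem_filter.2 ⟨hR, ?_⟩
    obtain ⟨B, ⟨h1, h2, h3⟩, -⟩ := hsel R (by rw [(mem_powersetCard.1 hR).2]; omega)
    refine ⟨B, h1, h2, h3, hkR.trans (card_le_card (Subset.trans ?_ subset_union_left))⟩
    have hvB : v B = v R := by
      rw [← union_eq_right.2 h1, hv.union_eq]
      intro s hs
      by_contra hne
      exact disjoint_left.1 h3 hs (mem_union_left _ (by simpa [violators] using hne))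
    intro s hs
    simp only [violators, mem_filter, mem_univ, true_and] at hs ⊢
    exact fun h => hs (hv.locality h1 hvB s h)
  · intro R hR
    simp only [mem_filter, mem_powersetCard, subset_univ, true_and] at hR ⊢
    obtain ⟨hRN, B, hBR, hBd, hdisj, hkB⟩ := hR
    refine ⟨hRN, ?_⟩
    have hBne : B.Nonempty := card_pos.1 (by omega)
    set m := B.max' hBne with hm
    have hmB : m ∈ B := max'_mem _ _
    -- The elements below the largest one of `B` are the `d - 1` others of `B` and those of `W B`.
    have hbelow : k + d - 1 ≤ m.val := by
      have hsub : B.erase m ∪ ({q | q ∉ B ∧ ∃ p ∈ B, q < p} : Finset (Fin n)) ⊆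
          ({i | i.val < m.val} : Finset (Fin n)) := by
        intro x hx
        simp only [mem_union, mem_erase, mem_filter, mem_univ, true_and] at hx ⊢
        rcases hx with ⟨hxm, hxB⟩ | ⟨-, p, hp, hxp⟩
        · exact lt_of_le_of_ne (Fin.le_def.1 (B.le_max' x hxB)) (Fin.val_ne_of_ne hxm)
        · exact lt_of_lt_of_le hxp (B.le_max' p hp)
      have hd' : Disjoint (B.erase m) ({q | q ∉ B ∧ ∃ p ∈ B, q < p} : Finset (Fin n)) := by
        refine disjoint_left.2 fun x hx hxW => ?_
        exact (mem_filter.1 hxW).2.1 (mem_of_mem_erase hx)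
      have := card_le_card hsub
      rw [card_union_of_disjoint hd', card_erase_of_mem hmB, hBd, Fin.card_filter_val_lt] at this
      omega
    have hsub : R ∩ ({i | i.val < k + d - 1} : Finset (Fin n)) ⊆ B.erase m := by
      intro x hx
      simp only [mem_inter, mem_filter, mem_univ, true_and] at hx
      have hxm : x < m := Fin.lt_def.2 (lt_of_lt_of_le hx.2 hbelow)
      refine mem_erase.2 ⟨hxm.ne, ?_⟩
      by_contra hxB
      exact disjoint_left.1 hdisj hx.1 (by
        simp only [mem_filter, mem_univ, true_and]
        exact ⟨hxB, m, hmB, hxm⟩)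
    have := card_le_card hsub
    rw [card_erase_of_mem hmB, hBd] at this
    omega

end Combinatorics

section MinMax

/-! ### Minimizing a maximum of strictly convex functions -/

open Finset Filter Topology

variable {ι E : Type*}

/-- The maximum of the functions `φ i`, `i ∈ R`; it is `⊥` if `R` is empty. -/
def maxOn (φ : ι → E → ℝ) (R : Finset ι) (x : E) : WithBot ℝ := R.sup fun i => (φ i x : WithBot ℝ)

/-- A point of `K` where `maxOn φ R` is minimal, if there is one. -/
noncomputable def minimizer [Nonempty E] (K : Set E) (φ : ι → E → ℝ) (R : Finset ι) : E :=
  Classical.epsilon fun x => x ∈ K ∧ ∀ y ∈ K, maxOn φ R x ≤ maxOn φ R y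

/-- The minimum of `maxOn φ R` over `K`. -/
noncomputable def minVal [Nonempty E] (K : Set E) (φ : ι → E → ℝ) (R : Finset ι) : WithBot ℝ :=
  maxOn φ R (minimizer K φ R)

lemma maxOn_le_iff {φ : ι → E → ℝ} {R : Finset ι} {x : E} {c : WithBot ℝ} :
    maxOn φ R x ≤ c ↔ ∀ i ∈ R, (φ i x : WithBot ℝ) ≤ c := Finset.sup_le_iff

lemma le_maxOn {φ : ι → E → ℝ} {R : Finset ι} {x : E} {i : ι} (hi : i ∈ R) :
    (φ i x : WithBot ℝ) ≤ maxOn φ R x := Finset.le_sup (f := fun i => (φ i x : WithBot ℝ)) hi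

lemma maxOn_mono {φ : ι → E → ℝ} {R R' : Finset ι} (h : R ⊆ R') (x : E) :
    maxOn φ R x ≤ maxOn φ R' x := Finset.sup_mono h

lemma maxOn_eq_coe_sup' (φ : ι → E → ℝ) {R : Finset ι} (hR : R.Nonempty) (x : E) :
    maxOn φ R x = ((R.sup' hR fun i => φ i x : ℝ) : WithBot ℝ) := by
  rw [maxOn, ← Finset.sup'_eq_sup hR]
  exact (Finset.apply_sup'_eq_sup'_comp hR (fun a : ℝ => (a : WithBot ℝ)) fun a b =>
    WithBot.coe_max a b).symm

lemma minimizer_congr [Nonempty E] {K : Set E} {φ φ' : ι → E → ℝ} {R : Finset ι}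
    (h : ∀ i ∈ R, φ i = φ' i) : minimizer K φ R = minimizer K φ' R := by
  have : maxOn φ R = maxOn φ' R := by
    funext x
    exact Finset.sup_congr rfl fun i hi => by rw [h i hi]
  simp only [minimizer, this]

lemma minVal_congr [Nonempty E] {K : Set E} {φ φ' : ι → E → ℝ} {R : Finset ι}
    (h : ∀ i ∈ R, φ i = φ' i) : minVal K φ R = minVal K φ' R := by
  rw [minVal, minVal, minimizer_congr h]
  exact Finset.sup_congr rfl fun i hi => by rw [h i hi]

lemma bot_lt_minVal [Nonempty E] {K : Set E} {φ : ι → E → ℝ} {R : Finset ι} (hR : R.Nonempty) : ⊥ < minVal K φ R := by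
  rw [minVal, maxOn_eq_coe_sup' φ hR]
  exact WithBot.bot_lt_coe _

variable [NormedAddCommGroup E] [NormedSpace ℝ E]

/-- A family of continuous strictly convex functions on a nonempty compact convex set. -/
structure IsConvexFamily (K : Set E) (φ : ι → E → ℝ) : Prop where
  compact : IsCompact K
  nonempty : K.Nonempty
  convex : ∀ i, StrictConvexOn ℝ K (φ i)
  cont : ∀ i, ContinuousOn (φ i) K

namespace IsConvexFamily

variable {K : Set E} {φ : ι → E → ℝ} (h : IsConvexFamily K φ)
include h

lemma comp {κ : Type*} (f : κ → ι) : IsConvexFamily K fun j => φ (f j) :=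
  ⟨h.compact, h.nonempty, fun j => h.convex (f j), fun j => h.cont (f j)⟩

lemma continuousOn_sup' {R : Finset ι} (hR : R.Nonempty) :
    ContinuousOn (fun x => R.sup' hR fun i => φ i x) K :=
  ContinuousOn.finset_sup'_apply hR fun i _ => h.cont i

lemma minimizer_spec (R : Finset ι) :
    minimizer K φ R ∈ K ∧ ∀ y ∈ K, minVal K φ R ≤ maxOn φ R y := by
  refine Classical.epsilon_spec (p := fun x => x ∈ K ∧ ∀ y ∈ K, maxOn φ R x ≤ maxOn φ R y) ?_
  rcases R.eq_empty_or_nonempty with rfl | hR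
  · obtain ⟨x, hx⟩ := h.nonempty
    exact ⟨x, hx, fun y _ => by simp [maxOn]⟩
  · obtain ⟨x, hx, hmin⟩ := h.compact.exists_isMinOn h.nonempty (h.continuousOn_sup' hR)
    refine ⟨x, hx, fun y hy => ?_⟩
    rw [maxOn_eq_coe_sup' φ hR, maxOn_eq_coe_sup' φ hR]
    exact WithBot.coe_le_coe.2 (hmin hy)

lemma minimizer_mem (R : Finset ι) : minimizer K φ R ∈ K := (h.minimizer_spec R).1

lemma minVal_le (R : Finset ι) {y : E} (hy : y ∈ K) : minVal K φ R ≤ maxOn φ R y :=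
  (h.minimizer_spec R).2 y hy

lemma eq_minimizer {R : Finset ι} (hR : R.Nonempty) {y : E} (hy : y ∈ K)
    (hle : maxOn φ R y ≤ minVal K φ R) : y = minimizer K φ R := by
  by_contra hne
  set x := minimizer K φ R
  have hmid : (1 / 2 : ℝ) • y + (1 / 2 : ℝ) • x ∈ K :=
    (h.convex hR.choose).1 hy (h.minimizer_mem R) (by norm_num) (by norm_num) (by norm_num)
  refine absurd (h.minVal_le R hmid) (not_le.2 ?_)
  refine (Finset.sup_lt_iff (bot_lt_minVal hR)).2 fun i hi => ?_
  have h1 := (h.convex i).2 hy (h.minimizer_mem R) hne 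
    (one_half_pos (α := ℝ)) (one_half_pos (α := ℝ)) (add_halves 1)
  have h2 : (φ i ((1 / 2 : ℝ) • y + (1 / 2 : ℝ) • x) : WithBot ℝ) < (max (φ i y) (φ i x) : ℝ) := by
    refine WithBot.coe_lt_coe.2 (h1.trans_le ?_)
    have := le_max_left (φ i y) (φ i x)
    have := le_max_right (φ i y) (φ i x)
    simp only [smul_eq_mul]
    linarith
  refine h2.trans_le ?_
  rw [WithBot.coe_max]
  exact max_le ((le_maxOn hi).trans hle) (le_maxOn hi)

lemma minVal_mono : Monotone (minVal K φ) := fun _ _ hRR' =>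
  (h.minVal_le _ (h.minimizer_mem _)).trans (maxOn_mono hRR' _)

lemma minimizer_eq_of_minVal_eq {R R' : Finset ι} (hRR' : R ⊆ R') (hR : R.Nonempty)
    (hv : minVal K φ R = minVal K φ R') : minimizer K φ R' = minimizer K φ R :=
  h.eq_minimizer hR (h.minimizer_mem R') ((maxOn_mono hRR' _).trans hv.ge)

variable [DecidableEq ι]

lemma minVal_insert_eq_iff {R : Finset ι} (hR : R.Nonempty) (s : ι) :
    minVal K φ (insert s R) = minVal K φ R ↔
      (φ s (minimizer K φ R) : WithBot ℝ) ≤ minVal K φ R := by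
  constructor
  · intro hv
    have hx := h.minimizer_eq_of_minVal_eq (subset_insert s R) hR hv.symm
    rw [← hv, ← hx]
    exact le_maxOn (mem_insert_self s R)
  · intro hle
    refine le_antisymm ?_ (h.minVal_mono (subset_insert s R))
    refine (h.minVal_le _ (h.minimizer_mem R)).trans (maxOn_le_iff.2 fun i hi => ?_)
    rcases mem_insert.1 hi with rfl | hi
    · exact hle
    · exact le_maxOn hi

lemma locality {R R' : Finset ι} (hRR' : R ⊆ R') (hv : minVal K φ R = minVal K φ R') (s : ι)
    (hs : minVal K φ (insert s R) = minVal K φ R) :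
    minVal K φ (insert s R') = minVal K φ R' := by
  rcases R.eq_empty_or_nonempty with rfl | hR
  · exact absurd (hs.trans (by simp [minVal, maxOn]))
      (bot_lt_minVal (insert_nonempty s ∅)).ne'
  · rw [h.minVal_insert_eq_iff (hR.mono hRR')]
    rw [h.minVal_insert_eq_iff hR] at hs
    rwa [h.minimizer_eq_of_minVal_eq hRR' hR hv, ← hv]

/-- Dropping the inactive functions does not change the minimum: otherwise a small step towards a
better point for the active ones would improve all of them. -/
lemma minVal_active (R : Finset ι) :
    minVal K φ {i ∈ R | (φ i (minimizer K φ R) : WithBot ℝ) = minVal K φ R} = minVal K φ R := by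
  rcases R.eq_empty_or_nonempty with rfl | hR
  · simp
  refine le_antisymm (h.minVal_mono (filter_subset _ _)) ?_
  set A : Finset ι := {i ∈ R | (φ i (minimizer K φ R) : WithBot ℝ) = minVal K φ R} with hA
  by_contra hlt
  rw [not_le] at hlt
  set x := minimizer K φ R with hx
  set y := minimizer K φ A with hy
  have hxK : x ∈ K := h.minimizer_mem R
  have hyK : y ∈ K := h.minimizer_mem A
  let c : ℝ → E := fun t => (1 - t) • x + t • y
  have hc0 : c 0 = x := by simp [c]
  have hcK : ∀ t ∈ Set.Icc (0 : ℝ) 1, c t ∈ K := fun t ht =>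
    (h.convex hR.choose).1 hxK hyK (by linarith [ht.2]) ht.1 (by ring)
  have hcont : Continuous c := by fun_prop
  have hev : ∀ i ∈ R, ∀ᶠ t in 𝓝[>] (0 : ℝ), (φ i (c t) : WithBot ℝ) < minVal K φ R := by
    intro i hi
    by_cases hiA : i ∈ A
    · filter_upwards [Ioc_mem_nhdsGT (zero_lt_one' ℝ)] with t ht
      have hxi : (φ i x : WithBot ℝ) = minVal K φ R := (mem_filter.1 hiA).2
      have hyi : φ i y < φ i x := by
        have : (φ i y : WithBot ℝ) < φ i x := by
          rw [hxi]
          exact (le_maxOn hiA).trans_lt hlt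
        exact WithBot.coe_lt_coe.1 this
      rw [← hxi, WithBot.coe_lt_coe]
      have := (h.convex i).convexOn.2 hxK hyK (sub_nonneg.2 ht.2) ht.1.le (sub_add_cancel 1 t)
      simp only [smul_eq_mul] at this
      nlinarith [ht.1]
    · have hlt' : (φ i x : WithBot ℝ) < minVal K φ R :=
        lt_of_le_of_ne (le_maxOn hi) fun heq => hiA (mem_filter.2 ⟨hi, heq⟩)
      rw [minVal, maxOn_eq_coe_sup' φ hR, WithBot.coe_lt_coe] at hlt'
      have htend : Tendsto (fun t => φ i (c t)) (𝓝[>] 0) (𝓝 (φ i x)) := by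
        have hci : Tendsto c (𝓝[>] 0) (𝓝[K] x) := by
          refine tendsto_nhdsWithin_iff.2 ⟨?_, ?_⟩
          · have := hcont.tendsto 0
            rw [hc0] at this
            exact this.mono_left nhdsWithin_le_nhds
          · filter_upwards [Ioc_mem_nhdsGT (zero_lt_one' ℝ)] with t ht
            exact hcK t ⟨ht.1.le, ht.2⟩
        exact (h.cont i x hxK).tendsto.comp hci
      filter_upwards [htend.eventually_lt_const hlt'] with t ht
      rw [minVal, maxOn_eq_coe_sup' φ hR, WithBot.coe_lt_coe]
      exact ht
  obtain ⟨t, ht, ht01⟩ := (((eventually_all_finset R).2 hev).and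
    (Ioc_mem_nhdsGT (zero_lt_one' ℝ))).exists
  refine absurd (h.minVal_le R (hcK t ⟨ht01.1.le, ht01.2⟩)) (not_le.2 ?_)
  exact (Finset.sup_lt_iff (bot_lt_minVal hR)).2 ht

/-- By Helly's theorem for the sublevel sets, at most `dim E + 1` constraints are essential. -/
lemma card_essential_le [FiniteDimensional ℝ E] (R : Finset ι) :
    #(essential (minVal K φ) R) ≤ Module.finrank ℝ E + 1 := by
  let F : ι → Set E := fun i => {x ∈ K | (φ i x : WithBot ℝ) < minVal K φ R}
  rcases R.eq_empty_or_nonempty with rfl | hR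
  · simp [essential]
  have hF : ∀ i ∈ R, Convex ℝ (F i) := by
    intro i _
    have : F i = {x ∈ K | φ i x < R.sup' hR fun j => φ j (minimizer K φ R)} := by
      ext x
      simp only [F, minVal, maxOn_eq_coe_sup' φ hR, WithBot.coe_lt_coe]
    rw [this]
    exact (h.convex i).convexOn.convex_lt _
  have hempty : ¬ (⋂ i ∈ R, F i).Nonempty := by
    rintro ⟨x, hx⟩
    simp only [Set.mem_iInter] at hx
    refine absurd (h.minVal_le R (hx _ hR.choose_spec).1) (not_le.2 ?_)
    exact (Finset.sup_lt_iff (bot_lt_minVal hR)).2 fun i hi => (hx i hi).2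
  obtain ⟨I, hIR, hIcard, hI⟩ : ∃ I ⊆ R, #I ≤ Module.finrank ℝ E + 1 ∧
      ¬ (⋂ i ∈ I, F i).Nonempty := by
    by_contra! hcon
    exact hempty (Convex.helly_theorem' hF hcon)
  refine (card_le_card fun s hs => ?_).trans hIcard
  by_contra hsI
  obtain ⟨-, hs⟩ := mem_filter.1 hs
  have hlt : minVal K φ (R.erase s) < minVal K φ R :=
    lt_of_le_of_ne (h.minVal_mono (erase_subset s R)) hs
  refine hI ⟨minimizer K φ (R.erase s), Set.mem_iInter₂.2 fun i hi => ⟨h.minimizer_mem _, ?_⟩⟩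
  exact (le_maxOn (mem_erase.2 ⟨fun his => hsI (by rwa [← his]), hIR hi⟩)).trans_lt hlt

/-- If no function outside `R` is active at the minimizer for `R`, then the active functions are
the essential ones, and the minimization problem is nondegenerate. -/
lemma isNondegenerateLPType [FiniteDimensional ℝ E]
    (hgen : ∀ R : Finset ι, R.Nonempty → ∀ s ∉ R,
      (φ s (minimizer K φ R) : WithBot ℝ) ≠ minVal K φ R) :
    IsNondegenerateLPType (Module.finrank ℝ E + 1) (minVal K φ) where
  mono := h.minVal_mono
  locality _ _ hRR' hv s hs := h.locality hRR' hv s hs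
  card_essential := h.card_essential_le
  value_essential R := by
    refine le_antisymm (h.minVal_mono (filter_subset _ _)) ?_
    rw [← h.minVal_active R]
    refine h.minVal_mono fun i hi => ?_
    obtain ⟨hi, hact⟩ := mem_filter.1 hi
    refine mem_filter.2 ⟨hi, fun heq => ?_⟩
    rcases (R.erase i).eq_empty_or_nonempty with hemp | hne
    · rw [hemp] at heq
      exact (bot_lt_minVal (K := K) (φ := φ) ⟨i, hi⟩).ne' (heq.symm.trans (by simp [minVal, maxOn]))
    · refine hgen _ hne i (notMem_erase i R) ?_
      rw [heq, ← h.minimizer_eq_of_minVal_eq (erase_subset i R) hne heq]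
      exact hact

end IsConvexFamily

end MinMax

section Perturbation

/-! ### Reduction to nondegenerate families by a small perturbation -/

open Finset Filter Topology

/-- Cluster points of approximate minimizers are minimizers. -/
lemma le_of_mapClusterPt {E α : Type*} [TopologicalSpace E] {K : Set E} {f : E → ℝ}
    (hf : ContinuousOn f K) {l : Filter α} {u : α → E} (hu : ∀ᶠ t in l, u t ∈ K) {x : E}
    (hx : x ∈ K) (hc : MapClusterPt x l u) {b : ℝ} {g : α → ℝ} (hg : Tendsto g l (𝓝 b))
    (hle : ∀ᶠ t in l, f (u t) ≤ g t) : f x ≤ b := by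
  by_contra! hlt
  obtain ⟨c, hbc, hcx⟩ := exists_between hlt
  have hU := (hf x hx).eventually (lt_mem_nhds hcx)
  rw [eventually_nhdsWithin_iff] at hU
  obtain ⟨t, htU, htK, hle, hgc⟩ :=
    ((hc.frequently hU).and_eventually
      (hu.and (hle.and (hg.eventually (gt_mem_nhds hbc))))).exists
  linarith [htU htK]

/-- A point of a small box that avoids finitely many graphs: for each `k`, the coordinate `s k` is
not the value `f k` determines from the other coordinates. A fine enough grid contains one. -/
lemma exists_generic {ι κ : Type*} [Fintype ι] [DecidableEq ι] [Fintype κ] (s : κ → ι)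
    (f : κ → (ι → ℝ) → ℝ) (hf : ∀ k w c, f k (Function.update w (s k) c) = f k w) {δ : ℝ}
    (hδ : 0 < δ) : ∃ w : ι → ℝ, ‖w‖ < δ ∧ ∀ k, w (s k) ≠ f k w := by
  set M : ℕ := Fintype.card κ + 1 with hM
  let step : Fin M → ℝ := fun j => δ / (2 * M) * (j.val : ℝ)
  have hMpos : (0 : ℝ) < M := by positivity
  have hstep : Function.Injective step := fun i j hij => by
    have hpos : δ / (2 * M) ≠ 0 := by positivity
    exact Fin.ext (by exact_mod_cast mul_left_cancel₀ hpos hij)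
  let pt : (ι → Fin M) → ι → ℝ := fun a i => step (a i)
  have hpt : ∀ a i c, pt (Function.update a i c) = Function.update (pt a) i (step c) := by
    intro a i c
    funext j
    by_cases hj : j = i
    · subst hj
      simp [pt]
    · simp [pt, hj]
  let bad : κ → Finset (ι → Fin M) := fun k => {a | pt a (s k) = f k (pt a)}
  have hbad : ∀ k, #(bad k) * M ≤ M ^ Fintype.card ι := by
    intro k
    have : #(bad k ×ˢ (univ : Finset (Fin M))) ≤ #(univ : Finset (ι → Fin M)) := by
      refine card_le_card_of_injOn (fun q => Function.update q.1 (s k) q.2) (by simp) ?_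
      rintro ⟨a, m⟩ ha ⟨a', m'⟩ ha' heq
      simp only [coe_product, Set.mem_prod, mem_coe, bad, mem_filter, mem_univ, true_and,
        and_true] at ha ha'
      have hm : m = m' := by simpa using congrFun heq (s k)
      have hoff : ∀ j, j ≠ s k → a j = a' j := fun j hj => by
        simpa [hj] using congrFun heq j
      have hfa : f k (pt a) = f k (pt a') := by
        rw [← hf k (pt a) (step m), ← hf k (pt a') (step m), ← hpt, ← hpt]
        congr 2
        simpa [hm] using heq
      have hs : a (s k) = a' (s k) := hstep (ha.trans (hfa.trans ha'.symm))
      refine Prod.ext (funext fun j => ?_) hm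
      by_cases hj : j = s k
      · exact hj ▸ hs
      · exact hoff j hj
    simpa [card_product] using this
  obtain ⟨a, ha⟩ : ∃ a, a ∉ univ.biUnion bad := by
    by_contra! hall
    have h1 : #(univ : Finset (ι → Fin M)) ≤ ∑ k, #(bad k) :=
      (card_le_card fun a _ => hall a).trans card_biUnion_le
    have h2 : (∑ k, #(bad k)) * M ≤ Fintype.card κ * M ^ Fintype.card ι := by
      rw [sum_mul]
      exact (sum_le_sum fun k _ => hbad k).trans_eq (by simp)
    rw [card_univ, Fintype.card_fun, Fintype.card_fin] at h1
    have h3 := (Nat.mul_le_mul_right M h1).trans h2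
    rw [mul_comm (Fintype.card κ)] at h3
    have := Nat.le_of_mul_le_mul_left h3 (by positivity)
    omega
  refine ⟨pt a, ?_, fun k hk => ha (mem_biUnion.2 ⟨k, mem_univ k, by simpa [bad] using hk⟩)⟩
  refine (pi_norm_lt_iff hδ).2 fun i => ?_
  have h1 : ((a i).val : ℝ) ≤ M := by exact_mod_cast (a i).isLt.le
  rw [Real.norm_of_nonneg (by positivity)]
  calc step (a i) ≤ δ / (2 * M) * M := by
        simp only [step]
        gcongr
    _ = δ / 2 := by field_simp
    _ < δ := by linarith

lemma sup'_add_le_and_le {ι E : Type*} [Fintype ι] {φ : ι → E → ℝ} {R : Finset ι} (hR : R.Nonempty) (w : ι → ℝ) (x : E) :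
    (R.sup' hR fun i => φ i x + w i) ≤ (R.sup' hR fun i => φ i x) + ‖w‖ ∧
      (R.sup' hR fun i => φ i x) ≤ (R.sup' hR fun i => φ i x + w i) + ‖w‖ := by
  have hw : ∀ i, |w i| ≤ ‖w‖ := fun i => norm_le_pi_norm w i
  constructor
  · refine sup'_le _ _ fun i hi => ?_
    have := le_sup' (fun i => φ i x) hi
    have := (abs_le.1 (hw i)).2
    linarith
  · refine sup'_le _ _ fun i hi => ?_
    have := le_sup' (fun i => φ i x + w i) hi
    have := (abs_le.1 (hw i)).1
    linarith

lemma exists_generic_perturbation {ι E : Type*} [Fintype ι] [DecidableEq ι] [Nonempty E]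
    {K : Set E} {φ : ι → E → ℝ} {δ : ℝ} (hδ : 0 < δ) :
    ∃ w : ι → ℝ, ‖w‖ < δ ∧ ∀ R : Finset ι, R.Nonempty → ∀ s ∉ R,
      ((φ s (minimizer K (fun i x => φ i x + w i) R) + w s : ℝ) : WithBot ℝ) ≠
        minVal K (fun i x => φ i x + w i) R := by
  classical
  obtain ⟨w, hwδ, hw⟩ := exists_generic
    (κ := {q : Finset ι × ι // q.1.Nonempty ∧ q.2 ∉ q.1}) (fun k => k.1.2)
    (fun k w => (minVal K (fun i x => φ i x + w i) k.1.1).unbotD 0 -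
      φ k.1.2 (minimizer K (fun i x => φ i x + w i) k.1.1)) (by
        rintro ⟨⟨R, s⟩, hR, hs⟩ w c
        have hcongr : ∀ i ∈ R, (fun x => φ i x + Function.update w s c i) =
            fun x => φ i x + w i := by
          intro i hi
          rw [Function.update_of_ne]
          rintro rfl
          exact hs hi
        simp only at hcongr ⊢
        rw [minVal_congr (φ' := fun i x => φ i x + w i) hcongr,
          minimizer_congr (φ' := fun i x => φ i x + w i) hcongr]) hδ
  refine ⟨w, hwδ, fun R hR s hs heq => hw ⟨(R, s), hR, hs⟩ ?_⟩
  simp only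
  rw [← heq, WithBot.unbotD_coe]
  ring

namespace IsConvexFamily

variable {ι E : Type*} [NormedAddCommGroup E] [NormedSpace ℝ E] {K : Set E} {φ : ι → E → ℝ}
  (h : IsConvexFamily K φ)
include h

lemma add_const (w : ι → ℝ) : IsConvexFamily K fun i x => φ i x + w i :=
  ⟨h.compact, h.nonempty, fun i => (h.convex i).add_const (w i),
    fun i => (h.cont i).add continuousOn_const⟩

variable [Fintype ι]

lemma tendsto_minimizer_add_const {R : Finset ι} (hR : R.Nonempty) :
    Tendsto (fun w : ι → ℝ => minimizer K (fun i x => φ i x + w i) R) (𝓝 0)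
      (𝓝 (minimizer K φ R)) := by
  have hmem : ∀ w : ι → ℝ, minimizer K (fun i x => φ i x + w i) R ∈ K := fun w =>
    (h.add_const w).minimizer_mem R
  refine h.compact.tendsto_nhds_of_unique_mapClusterPt (Eventually.of_forall hmem)
    fun x hx hcl => h.eq_minimizer hR hx ?_
  rw [minVal, maxOn_eq_coe_sup' φ hR, maxOn_eq_coe_sup' φ hR, WithBot.coe_le_coe]
  refine le_of_mapClusterPt (h.continuousOn_sup' hR) (Eventually.of_forall hmem) hx hcl
    (g := fun w => (R.sup' hR fun i => φ i (minimizer K φ R)) + 2 * ‖w‖) ?_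
    (Eventually.of_forall fun w => ?_)
  · have : Continuous fun w : ι → ℝ =>
        (R.sup' hR fun i => φ i (minimizer K φ R)) + 2 * ‖w‖ := by fun_prop
    simpa using this.tendsto 0
  · have h1 := (h.add_const w).minVal_le R (h.minimizer_mem R)
    rw [minVal, maxOn_eq_coe_sup' _ hR, maxOn_eq_coe_sup' _ hR, WithBot.coe_le_coe] at h1
    have h2 := (sup'_add_le_and_le hR w (minimizer K φ R) (φ := φ)).1
    have h3 := (sup'_add_le_and_le hR w (minimizer K (fun i x => φ i x + w i) R) (φ := φ)).2
    linarith

lemma eventually_violates {R : Finset ι} (hR : R.Nonempty) {s : ι}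
    (hs : minVal K φ R < φ s (minimizer K φ R)) :
    ∀ᶠ w : ι → ℝ in 𝓝 0, minVal K (fun i x => φ i x + w i) R <
      (φ s (minimizer K (fun i x => φ i x + w i) R) + w s : ℝ) := by
  rw [minVal, maxOn_eq_coe_sup' φ hR, WithBot.coe_lt_coe] at hs
  have hmem : ∀ w : ι → ℝ, minimizer K (fun i x => φ i x + w i) R ∈ K := fun w =>
    (h.add_const w).minimizer_mem R
  have hK : Tendsto (fun w : ι → ℝ => minimizer K (fun i x => φ i x + w i) R) (𝓝 0)
      (𝓝[K] (minimizer K φ R)) :=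
    tendsto_nhdsWithin_iff.2 ⟨h.tendsto_minimizer_add_const hR, Eventually.of_forall hmem⟩
  have h1 : Tendsto (fun w : ι → ℝ => φ s (minimizer K (fun i x => φ i x + w i) R) + w s) (𝓝 0)
      (𝓝 (φ s (minimizer K φ R) + (0 : ι → ℝ) s)) :=
    ((h.cont s _ (h.minimizer_mem R)).tendsto.comp hK).add ((continuous_apply s).tendsto 0)
  have h2 : Tendsto (fun w : ι → ℝ => (R.sup' hR fun i => φ i (minimizer K φ R)) + ‖w‖) (𝓝 0)
      (𝓝 ((R.sup' hR fun i => φ i (minimizer K φ R)) + ‖(0 : ι → ℝ)‖)) :=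
    (by fun_prop : Continuous fun w : ι → ℝ =>
      (R.sup' hR fun i => φ i (minimizer K φ R)) + ‖w‖).tendsto 0
  have h12 := h2.eventually_lt h1 (by simpa using hs)
  filter_upwards [h12] with w hw
  have h3 := (h.add_const w).minVal_le R (h.minimizer_mem R)
  refine h3.trans_lt ?_
  rw [maxOn_eq_coe_sup' _ hR, WithBot.coe_lt_coe]
  exact (sup'_add_le_and_le hR w (minimizer K φ R) (φ := φ)).1.trans_lt hw

variable [DecidableEq ι]

/-- The bound on the number of sets with many violators holds without nondegeneracy, since strict
violations persist under small perturbations. -/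
theorem card_le [FiniteDimensional ℝ E] {d : ℕ} (hd : d = Module.finrank ℝ E + 1) {N k : ℕ}
    (hN : d ≤ N) (hk : k + d - 1 ≤ Fintype.card ι) :
    #{R ∈ powersetCard N (univ : Finset ι) |
        k ≤ #{s | minVal K φ R < φ s (minimizer K φ R)}} ≤
      ∑ i ∈ range d,
        (k + d - 1).choose i * (Fintype.card ι - (k + d - 1)).choose (N - i) := by
  have hev : ∀ᶠ w : ι → ℝ in 𝓝 0, ∀ R : Finset ι, ∀ s : ι, R.Nonempty →
      minVal K φ R < φ s (minimizer K φ R) →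
      minVal K (fun i x => φ i x + w i) R <
        (φ s (minimizer K (fun i x => φ i x + w i) R) + w s : ℝ) := by
    simp only [eventually_all]
    exact fun R s hR hs => h.eventually_violates hR hs
  obtain ⟨δ, hδ, hball⟩ := Metric.eventually_nhds_iff.1 hev
  obtain ⟨w, hwδ, hgen⟩ := exists_generic_perturbation (K := K) (φ := φ) hδ
  have hw := hball (y := w) (by simpa using hwδ)
  have hfam := h.add_const w
  refine (card_le_card ?_).trans
    ((hd ▸ hfam.isNondegenerateLPType hgen).card_le (by omega) hN hk)
  intro R hR
  obtain ⟨hRN, hkR⟩ := mem_filter.1 hR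
  have hRne : R.Nonempty := card_pos.1 (by rw [(mem_powersetCard.1 hRN).2]; omega)
  refine mem_filter.2 ⟨hRN, hkR.trans (card_le_card fun s hs => ?_)⟩
  refine mem_filter.2 ⟨mem_univ s, fun heq => ?_⟩
  rw [hfam.minVal_insert_eq_iff hRne] at heq
  exact absurd (hw R s hRne (mem_filter.1 hs).2) (not_lt.2 heq)

end IsConvexFamily

end Perturbation

section Measurability

/-! ### Measurability of the minimizer and exchangeability of the samples -/

open Finset Filter Topology

/-- A unique minimizer over a compact set of functions that are continuous and depend measurably on
a parameter depends measurably on the parameter: it lies in a closed set `A` if and only if the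
infimum over a countable dense part of `A ∩ K` is at most that over one of `K`. -/
lemma measurable_of_unique_minimizer {Ω E : Type*} [MeasurableSpace Ω] [MetricSpace E]
    [MeasurableSpace E] [BorelSpace E] {K : Set E} (hK : IsCompact K) {m : Ω → E → ℝ} {u : Ω → E}
    (hcont : ∀ ω, ContinuousOn (m ω) K) (hm : ∀ x ∈ K, Measurable fun ω => m ω x)
    (hu : ∀ ω, u ω ∈ K) (hmin : ∀ ω, ∀ y ∈ K, m ω (u ω) ≤ m ω y)
    (huniq : ∀ ω, ∀ y ∈ K, m ω y ≤ m ω (u ω) → y = u ω) : Measurable u := by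
  refine measurable_of_isClosed fun A hA => ?_
  have hKA : IsCompact (A ∩ K) := hK.inter_left hA
  obtain ⟨D, hDK, hDc, hD⟩ := hK.isSeparable.exists_countable_dense_subset
  obtain ⟨D', hD'K, hD'c, hD'⟩ := hKA.isSeparable.exists_countable_dense_subset
  have hdense : ∀ (ω : Ω) (B C : Set E), C ⊆ B → B ⊆ K → B ⊆ closure C → ∀ y ∈ B, ∀ q : ℝ,
      m ω y < q → ∃ x ∈ C, m ω x < q := by
    intro ω B C hCB hBK hBC y hy q hq
    have h1 := (hcont ω y (hBK hy)).eventually (gt_mem_nhds hq)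
    rw [eventually_nhdsWithin_iff] at h1
    obtain ⟨x, hxC, hx⟩ := ((mem_closure_iff_frequently.1 (hBC hy)).and_eventually h1).exists
    exact ⟨x, hxC, hx (hBK (hCB hxC))⟩
  have hset : u ⁻¹' A = ⋂ q : ℚ, (⋃ x ∈ D, {ω | m ω x < q})ᶜ ∪ ⋃ x ∈ D', {ω | m ω x < q} := by
    ext ω
    simp only [Set.mem_preimage, Set.mem_iInter, Set.mem_union, Set.mem_compl_iff, Set.mem_iUnion,
      Set.mem_ofPred_eq, exists_prop]
    constructor
    · intro hω q
      refine or_iff_not_imp_left.2 fun hq => ?_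
      obtain ⟨x, hx, hxq⟩ := not_not.1 hq
      exact hdense ω _ _ hD'K Set.inter_subset_right hD' (u ω) ⟨hω, hu ω⟩ q
        ((hmin ω x (hDK hx)).trans_lt hxq)
    · intro hq
      by_contra hω
      have hlow : ∃ q : ℚ, m ω (u ω) < q ∧ ∀ x ∈ A ∩ K, (q : ℝ) ≤ m ω x := by
        rcases (A ∩ K).eq_empty_or_nonempty with hemp | hne
        · obtain ⟨q, hq⟩ := exists_rat_gt (m ω (u ω))
          exact ⟨q, hq, by simp [hemp]⟩
        · obtain ⟨y, hy, hymin⟩ := hKA.exists_isMinOn hne ((hcont ω).mono Set.inter_subset_right)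
          have hlt : m ω (u ω) < m ω y := by
            by_contra! hle
            exact hω (huniq ω y hy.2 hle ▸ hy.1)
          obtain ⟨q, hq1, hq2⟩ := exists_rat_btwn hlt
          exact ⟨q, hq1, fun x hx => hq2.le.trans (hymin hx)⟩
      obtain ⟨q, hq1, hq2⟩ := hlow
      rcases hq q with h | ⟨x, hx, hxq⟩
      · exact h (hdense ω _ _ hDK Set.Subset.rfl hD (u ω) (hu ω) q hq1)
      · exact absurd hxq (not_lt.2 (hq2 x (hD'K hx)))
  rw [hset]
  refine MeasurableSet.iInter fun q => MeasurableSet.union (MeasurableSet.compl ?_) ?_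
  · exact MeasurableSet.biUnion hDc fun x hx => measurableSet_lt (hm x (hDK hx)) measurable_const
  · exact MeasurableSet.biUnion hD'c fun x hx =>
      measurableSet_lt (hm x (hD'K hx).2) measurable_const

section

variable {S E ι : Type*} [Nonempty E] {K : Set E} {Φ : S → E → ℝ}

/-- The samples `s` whose function exceeds the minimum found for the samples `ω i`, `i ∈ R`. -/
def violationSet (K : Set E) (Φ : S → E → ℝ) (ω : ι → S) (R : Finset ι) : Set S :=
  {s | minVal K (fun i => Φ (ω i)) R < Φ s (minimizer K (fun i => Φ (ω i)) R)}

lemma mem_violationSet_iff {ω : ι → S} {R : Finset ι} (hR : R.Nonempty) {s : S} :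
    s ∈ violationSet K Φ ω R ↔ (R.sup' hR fun i => Φ (ω i) (minimizer K (fun i => Φ (ω i)) R)) <
      Φ s (minimizer K (fun i => Φ (ω i)) R) := by
  rw [violationSet, Set.mem_ofPred_eq, minVal, maxOn_eq_coe_sup' _ hR, WithBot.coe_lt_coe]

omit [Nonempty E] in
lemma maxOn_map {κ : Type*} (φ : ι → E → ℝ) (f : κ ↪ ι) (R : Finset κ) :
    maxOn φ (R.map f) = maxOn (fun j => φ (f j)) R := by
  funext x
  simp only [maxOn, sup_map]
  rfl

lemma violationSet_map {κ : Type*} (ω : ι → S) (f : κ ↪ ι) (R : Finset κ) :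
    violationSet K Φ ω (R.map f) = violationSet K Φ (fun j => ω (f j)) R := by
  simp only [violationSet, minVal, minimizer, maxOn_map]

end

variable {S E : Type*} [MeasurableSpace S] [NormedAddCommGroup E] [NormedSpace ℝ E]
  {K : Set E} {Φ : S → E → ℝ}

section

variable {ι : Type*}

variable [MeasurableSpace E] [BorelSpace E]
  (h : IsConvexFamily K Φ) (hΦ : ∀ x ∈ K, Measurable fun s => Φ s x)
include h hΦ

lemma measurable_minimizer {R : Finset ι} (hR : R.Nonempty) :
    Measurable fun ω : ι → S => minimizer K (fun i => Φ (ω i)) R := by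
  refine measurable_of_unique_minimizer h.compact
    (m := fun ω x => R.sup' hR fun i => Φ (ω i) x) (fun ω => (h.comp ω).continuousOn_sup' hR)
    (fun x hx => ?_) (fun ω => (h.comp ω).minimizer_mem R) (fun ω y hy => ?_)
    fun ω y hy hle => ?_
  · have := Finset.measurable_sup' hR (f := fun i (ω : ι → S) => Φ (ω i) x)
      fun i _ => (hΦ x hx).comp (measurable_pi_apply i)
    convert this using 2
    rw [Finset.sup'_apply]
  · have := (h.comp ω).minVal_le R hy
    rwa [minVal, maxOn_eq_coe_sup' _ hR, maxOn_eq_coe_sup' _ hR, WithBot.coe_le_coe] at this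
  · refine (h.comp ω).eq_minimizer hR hy ?_
    rwa [minVal, maxOn_eq_coe_sup' _ hR, maxOn_eq_coe_sup' _ hR, WithBot.coe_le_coe]

lemma measurable_apply_minimizer [FiniteDimensional ℝ E] {R : Finset ι} (hR : R.Nonempty) :
    Measurable fun q : (ι → S) × S => Φ q.2 (minimizer K (fun i => Φ (q.1 i)) R) := by
  have h1 : Measurable (Function.uncurry fun (x : K) (s : S) => Φ s x) :=
    measurable_uncurry_of_continuous_of_measurable
      (fun s => continuousOn_iff_continuous_domRestrict.1 (h.cont s)) fun x => hΦ x x.2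
  have h2 : Measurable fun ω : ι → S =>
      (⟨minimizer K (fun i => Φ (ω i)) R, (h.comp ω).minimizer_mem R⟩ : K) :=
    (measurable_minimizer h hΦ hR).subtype_mk
  exact h1.comp ((h2.comp measurable_fst).prodMk measurable_snd)

lemma measurableSet_violation [FiniteDimensional ℝ E] {R : Finset ι} (hR : R.Nonempty) :
    MeasurableSet {q : (ι → S) × S | q.2 ∈ violationSet K Φ q.1 R} := by
  simp only [mem_violationSet_iff hR]
  refine measurableSet_lt ?_ (measurable_apply_minimizer h hΦ hR)
  have := Finset.measurable_sup' hR
    (f := fun i (q : (ι → S) × S) => Φ (q.1 i) (minimizer K (fun i => Φ (q.1 i)) R))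
    fun i _ => (measurable_apply_minimizer h hΦ hR).comp
      (measurable_fst.prodMk ((measurable_pi_apply i).comp measurable_fst))
  convert this using 2
  rw [Finset.sup'_apply]

end

lemma measurableSet_le_card {Ω ι : Type*} [MeasurableSpace Ω] [Fintype ι] (p : ι → Ω → Prop)
    [∀ i ω, Decidable (p i ω)] (hp : ∀ i, MeasurableSet {ω | p i ω}) (k : ℕ) :
    MeasurableSet {ω | k ≤ #{i | p i ω}} := by
  have : Measurable fun ω => #{i | p i ω} := by
    simp only [card_filter]
    exact Finset.measurable_fun_sum _ fun i _ =>
      Measurable.ite (hp i) measurable_const measurable_const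
  exact this measurableSet_Ici

variable [MeasurableSpace E] [BorelSpace E] [FiniteDimensional ℝ E]
  (h : IsConvexFamily K Φ) (hΦ : ∀ x ∈ K, Measurable fun s => Φ s x)
include h hΦ

open Classical in
/-- Since i.i.d. samples are exchangeable, the counting bound turns into a bound on the
probability that a fixed set of `N` samples has at least `k` violators among all samples. -/
theorem measure_le_card_violators_le {H : Type*} [Fintype H] (P : Measure S)
    [IsProbabilityMeasure P] {d : ℕ} (hd : d = Module.finrank ℝ E + 1) {N k : ℕ} (hN : d ≤ N)
    (hk : k + d - 1 ≤ Fintype.card H) (R₀ : Finset H) (hR₀ : #R₀ = N) :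
    Measure.pi (fun _ : H => P) {ω | k ≤ #{j | ω j ∈ violationSet K Φ ω R₀}} ≤
      ENNReal.ofReal ((∑ i ∈ range d, ((k + d - 1).choose i : ℝ) *
        (Fintype.card H - (k + d - 1)).choose (N - i)) / (Fintype.card H).choose N) := by
  let Ev : Finset H → Set (H → S) := fun R => {ω | k ≤ #{j | ω j ∈ violationSet K Φ ω R}}
  have hcardR : ∀ R ∈ powersetCard N (univ : Finset H), R.Nonempty := fun R hR =>
    card_pos.1 (by rw [(mem_powersetCard.1 hR).2]; omega)
  have hmeas : ∀ R ∈ powersetCard N (univ : Finset H), MeasurableSet (Ev R) := fun R hR => by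
    refine measurableSet_le_card _ (fun j => ?_) k
    exact (measurable_id.prodMk (measurable_pi_apply j))
      (measurableSet_violation h hΦ (hcardR R hR))
  have hexch : ∀ R ∈ powersetCard N (univ : Finset H),
      Measure.pi (fun _ : H => P) (Ev R) = Measure.pi (fun _ : H => P) (Ev R₀) := by
    intro R hR
    obtain ⟨σ, hσ⟩ := Equiv.Perm.exists_map_finset_eq R R₀
      ((mem_powersetCard.1 hR).2.trans hR₀.symm)
    have hmp := measurePreserving_piCongrLeft (fun _ : H => P) σ
    rw [← hmp.measure_preimage_equiv (Ev R₀)]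
    congr 1
    ext ω
    have hω : ∀ i, (MeasurableEquiv.piCongrLeft (fun _ : H => S) σ) ω (σ i) = ω i := fun i =>
      MeasurableEquiv.piCongrLeft_apply_apply σ (β := fun _ => S) ω i
    simp only [Ev, Set.mem_ofPred_eq, Set.mem_preimage, ← hσ, violationSet_map,
      Equiv.coe_toEmbedding, hω]
    have : #{j | ω j ∈ violationSet K Φ ω R} =
        #{j | (MeasurableEquiv.piCongrLeft (fun _ : H => S) σ) ω j ∈ violationSet K Φ ω R} :=
      card_equiv σ fun i => by simp [hω]
    rw [this]
  have hsum : ∑ R ∈ powersetCard N (univ : Finset H), Measure.pi (fun _ : H => P) (Ev R) ≤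
      ENNReal.ofReal (∑ i ∈ range d, ((k + d - 1).choose i : ℝ) *
        (Fintype.card H - (k + d - 1)).choose (N - i)) := by
    calc _ = ∫⁻ ω, ∑ R ∈ powersetCard N (univ : Finset H), (Ev R).indicator 1 ω
          ∂(Measure.pi fun _ : H => P) := by
          rw [lintegral_finsetSum' _ fun R hR =>
            (measurable_one.indicator (hmeas R hR)).aemeasurable]
          exact sum_congr rfl fun R hR => (lintegral_indicator_one (hmeas R hR)).symm
      _ ≤ ∫⁻ ω, ENNReal.ofReal (∑ i ∈ range d, ((k + d - 1).choose i : ℝ) *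
            (Fintype.card H - (k + d - 1)).choose (N - i)) ∂(Measure.pi fun _ : H => P) := by
          refine lintegral_mono fun ω => ?_
          have hcount : #{R ∈ powersetCard N (univ : Finset H) | ω ∈ Ev R} ≤ ∑ i ∈ range d,
              (k + d - 1).choose i * (Fintype.card H - (k + d - 1)).choose (N - i) := by
            refine le_trans (card_le_card fun R hR => ?_) ((h.comp ω).card_le hd hN hk)
            refine mem_filter.2 ⟨(mem_filter.1 hR).1, (mem_filter.1 hR).2.trans (le_of_eq ?_)⟩
            exact congrArg card (filter_congr fun _ _ => Iff.rfl)
          have : ∑ R ∈ powersetCard N (univ : Finset H), (Ev R).indicator (1 : (H → S) → ENNReal) ω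
              = (#{R ∈ powersetCard N (univ : Finset H) | ω ∈ Ev R} : ℕ) := by
            rw [card_filter, Nat.cast_sum]
            refine sum_congr rfl fun R _ => ?_
            by_cases hω : ω ∈ Ev R <;> simp [hω]
          rw [this, ← ENNReal.ofReal_natCast]
          refine ENNReal.ofReal_le_ofReal ?_
          exact_mod_cast hcount
      _ = _ := by simp
  rw [sum_congr rfl hexch, sum_const, card_powersetCard, card_univ, nsmul_eq_mul] at hsum
  have hpos : 0 < (Fintype.card H).choose N := by
    refine Nat.choose_pos ?_
    rw [← hR₀]
    exact card_le_univ R₀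
  have hpos' : (0 : ℝ) < (Fintype.card H).choose N := by exact_mod_cast hpos
  rw [ENNReal.ofReal_div_of_pos hpos', ENNReal.ofReal_natCast]
  refine (ENNReal.le_div_iff_mul_le (Or.inl (by exact_mod_cast hpos.ne')) (Or.inl (by simp))).2 ?_
  rw [mul_comm]
  exact hsum

end Measurability

section BinomialTail

/-! ### The binomial tail -/

open Finset Filter Topology

/-- The probability that a binomial random variable with parameters `N` and `ε` is less
than `c`. -/
def binTail (c : ℕ) (ε : ℝ) (N : ℕ) : ℝ :=
  ∑ i ∈ range c, (N.choose i : ℝ) * ε ^ i * (1 - ε) ^ (N - i)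

lemma binTail_succ_le {ε : ℝ} (h0 : 0 ≤ ε) (h1 : ε ≤ 1) (c N : ℕ) :
    binTail c ε (N + 1) ≤ binTail c ε N := by
  have h1' : 0 ≤ 1 - ε := by linarith
  have hstep : ∀ i, ((N + 1).choose (i + 1) : ℝ) * ε ^ (i + 1) * (1 - ε) ^ (N + 1 - (i + 1)) =
      ε * ((N.choose i : ℝ) * ε ^ i * (1 - ε) ^ (N - i)) +
        (1 - ε) * ((N.choose (i + 1) : ℝ) * ε ^ (i + 1) * (1 - ε) ^ (N - (i + 1))) := by
    intro i
    rw [Nat.choose_succ_succ, Nat.add_sub_add_right]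
    push_cast
    rcases lt_or_ge i N with hi | hi
    · rw [show N - i = N - (i + 1) + 1 by omega]
      ring
    · rw [Nat.choose_eq_zero_of_lt (show N < i + 1 by omega)]
      push_cast
      ring
  cases c with
  | zero => simp [binTail]
  | succ c =>
    have hnonneg : 0 ≤ (N.choose c : ℝ) * ε ^ c * (1 - ε) ^ (N - c) := by positivity
    have h3 : binTail (c + 1) ε (N + 1) =
        ε * binTail c ε N + (1 - ε) * binTail (c + 1) ε N := by
      unfold binTail
      rw [sum_range_succ', sum_congr rfl fun i _ => hstep i, sum_add_distrib, ← mul_sum,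
        ← mul_sum, sum_range_succ' _ c]
      simp only [Nat.choose_zero_right, Nat.cast_one, pow_zero, one_mul, Nat.sub_zero, pow_succ]
      ring
    have h4 : binTail (c + 1) ε N = binTail c ε N +
        (N.choose c : ℝ) * ε ^ c * (1 - ε) ^ (N - c) := sum_range_succ _ _
    rw [h3]
    nlinarith

lemma binTail_antitone {ε : ℝ} (h0 : 0 ≤ ε) (h1 : ε ≤ 1) (c : ℕ) : Antitone (binTail c ε) :=
  antitone_nat_of_succ_le (binTail_succ_le h0 h1 c)

lemma binTail_eq_one_of_lt {c N : ℕ} (h : N < c) (ε : ℝ) : binTail c ε N = 1 := by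
  have : binTail (N + 1) ε N = 1 := by
    have := add_pow ε (1 - ε) N
    rw [add_sub_cancel, one_pow] at this
    rw [this, binTail]
    exact sum_congr rfl fun i _ => by ring
  rw [← this, binTail, binTail]
  symm
  refine sum_subset (range_mono h) fun i _ hi => ?_
  rw [Nat.choose_eq_zero_of_lt (by simpa using hi)]
  simp

lemma binTail_zero {c N : ℕ} (hc : 1 ≤ c) : binTail c 0 N = 1 := by
  obtain ⟨c, rfl⟩ := Nat.exists_eq_add_of_le' hc
  simp [binTail, sum_range_succ']

lemma tendsto_sub_div {a : ℕ → ℕ} {x : ℝ} (h : Tendsto (fun M => (a M : ℝ) / M) atTop (𝓝 x))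
    (j : ℕ) : Tendsto (fun M => ((a M - j : ℕ) : ℝ) / M) atTop (𝓝 x) := by
  have hj : Tendsto (fun M : ℕ => (j : ℝ) / M) atTop (𝓝 0) := tendsto_const_div_atTop_nhds_zero_nat _
  have hlow := h.sub hj
  rw [sub_zero] at hlow
  refine tendsto_of_tendsto_of_tendsto_of_le_of_le hlow h (fun M => ?_) fun M => ?_
  · have : (a M : ℝ) ≤ (a M - j : ℕ) + j := by exact_mod_cast le_tsub_add
    rw [← sub_div]
    gcongr
    linarith
  · beta_reduce
    gcongr
    exact Nat.sub_le _ _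

lemma tendsto_choose_div_pow {a : ℕ → ℕ} {x : ℝ}
    (h : Tendsto (fun M => (a M : ℝ) / M) atTop (𝓝 x)) (i : ℕ) :
    Tendsto (fun M => ((a M).choose i : ℝ) / (M : ℝ) ^ i) atTop (𝓝 (x ^ i / i.factorial)) := by
  have h1 : Tendsto (fun M => ∏ j ∈ range i, ((a M - j : ℕ) : ℝ) / M) atTop
      (𝓝 (∏ _j ∈ range i, x)) := tendsto_finsetProd _ fun j _ => tendsto_sub_div h j
  rw [prod_const, card_range] at h1
  refine (h1.div_const (i.factorial : ℝ)).congr fun M => ?_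
  rw [prod_div_distrib, prod_const, card_range, ← Nat.cast_prod, ← Nat.descFactorial_eq_prod_range,
    Nat.descFactorial_eq_factorial_mul_choose]
  have : (i.factorial : ℝ) ≠ 0 := by positivity
  push_cast
  field_simp

/-- The hypergeometric distribution tends to the binomial one. -/
lemma tendsto_hypergeometric {ε : ℝ} {a : ℕ → ℕ} {N d : ℕ} (hd : d ≤ N)
    (ha : Tendsto (fun M => (a M : ℝ) / M) atTop (𝓝 ε)) (haN : ∀ M, a M ≤ N + M) :
    Tendsto (fun M => (∑ i ∈ range d, ((a M).choose i : ℝ) * (N + M - a M).choose (N - i)) /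
      (N + M).choose N) atTop (𝓝 (binTail d ε N)) := by
  have hn : Tendsto (fun M : ℕ => ((N + M : ℕ) : ℝ) / M) atTop (𝓝 1) := by
    have : Tendsto (fun M : ℕ => (N : ℝ) / M + 1) atTop (𝓝 (0 + 1)) :=
      (tendsto_const_div_atTop_nhds_zero_nat _).add_const 1
    rw [zero_add] at this
    refine this.congr' ?_
    filter_upwards [eventually_gt_atTop 0] with M hM
    have : (M : ℝ) ≠ 0 := by positivity
    push_cast
    field_simp
  have hb : Tendsto (fun M : ℕ => ((N + M - a M : ℕ) : ℝ) / M) atTop (𝓝 (1 - ε)) := by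
    refine (hn.sub ha).congr fun M => ?_
    rw [Nat.cast_sub (haN M), sub_div]
  have hden := tendsto_choose_div_pow hn N
  have hnum : Tendsto (fun M => ∑ i ∈ range d, (((a M).choose i : ℝ) / (M : ℝ) ^ i) *
      (((N + M - a M).choose (N - i) : ℝ) / (M : ℝ) ^ (N - i))) atTop
      (𝓝 (∑ i ∈ range d, (ε ^ i / i.factorial) * ((1 - ε) ^ (N - i) / (N - i).factorial))) :=
    tendsto_finsetSum _ fun i _ => (tendsto_choose_div_pow ha i).mul (tendsto_choose_div_pow hb _)
  have hlim : (∑ i ∈ range d, (ε ^ i / i.factorial) * ((1 - ε) ^ (N - i) / (N - i).factorial)) /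
      ((1 : ℝ) ^ N / N.factorial) = binTail d ε N := by
    rw [sum_div, binTail]
    refine sum_congr rfl fun i hi => ?_
    rw [mem_range] at hi
    rw [Nat.cast_choose ℝ (show i ≤ N by omega)]
    have h1 : (i.factorial : ℝ) ≠ 0 := by positivity
    have h2 : ((N - i).factorial : ℝ) ≠ 0 := by positivity
    have h3 : (N.factorial : ℝ) ≠ 0 := by positivity
    field_simp
    simp
  rw [← hlim]
  refine (hnum.div hden (by positivity)).congr' ?_
  filter_upwards [eventually_gt_atTop 0] with M hM
  have hM' : (M : ℝ) ^ N ≠ 0 := by positivity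
  have : ∑ i ∈ range d, (((a M).choose i : ℝ) / (M : ℝ) ^ i) *
      (((N + M - a M).choose (N - i) : ℝ) / (M : ℝ) ^ (N - i)) =
      (∑ i ∈ range d, ((a M).choose i : ℝ) * (N + M - a M).choose (N - i)) / (M : ℝ) ^ N := by
    rw [sum_div]
    refine sum_congr rfl fun i hi => ?_
    rw [mem_range] at hi
    rw [div_mul_div_comm, ← pow_add, Nat.add_sub_cancel' (show i ≤ N by omega)]
  simp only [Pi.div_apply, this]
  rw [div_div_div_cancel_right₀ hM']

end BinomialTail

section LawOfLargeNumbers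

/-! ### The number of samples in a given set -/

open Finset Filter Topology ProbabilityTheory

open Classical in
/-- The weak law of large numbers for the number of samples that fall into a given set. -/
lemma tendsto_measure_ceil_le_card {S : Type*} [MeasurableSpace S] (P : Measure S)
    [IsProbabilityMeasure P] {A : Set S} (hA : MeasurableSet A) {ε : ℝ} (hε : ε < P.real A) :
    Tendsto (fun M : ℕ => Measure.pi (fun _ : Fin M => P)
      {ω | ⌈ε * M⌉₊ ≤ #{j | ω j ∈ A}}) atTop (𝓝 1) := by
  set c : ℝ := P.real A - ε with hc
  have hcpos : 0 < c := by linarith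
  let f : S → ℝ := A.indicator 1
  have hf : MemLp f 2 P := (memLp_const (1 : ℝ)).indicator hA
  have hcount : ∀ (M : ℕ) (ω : Fin M → S), ((#{j | ω j ∈ A} : ℕ) : ℝ) = ∑ j, f (ω j) := by
    intro M ω
    rw [card_filter, Nat.cast_sum]
    refine sum_congr rfl fun j _ => ?_
    by_cases hj : ω j ∈ A <;> simp [f, hj]
  have hvar : Var[f; P] ≤ 1 := by
    refine (variance_le_expectation_sq hf.1).trans ?_
    have : (f ^ 2) = A.indicator (1 : S → ℝ) := by
      funext s
      by_cases hs : s ∈ A <;> simp [f, hs]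
    rw [this, integral_indicator_one hA]
    exact measureReal_le_one
  have hbound : ∀ M : ℕ, 0 < M → 1 - ENNReal.ofReal (1 / (c ^ 2 * M)) ≤
      Measure.pi (fun _ : Fin M => P) {ω | ⌈ε * M⌉₊ ≤ #{j | ω j ∈ A}} := by
    intro M hM
    have hM' : (0 : ℝ) < M := by exact_mod_cast hM
    let X : (Fin M → S) → ℝ := ∑ j, fun ω => f (ω j)
    have hXapp : ∀ ω, X ω = ∑ j, f (ω j) := fun ω => by simp [X]
    have hfj : ∀ j : Fin M, MemLp (fun ω : Fin M → S => f (ω j)) 2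
        (Measure.pi fun _ : Fin M => P) := fun j =>
      hf.comp_measurePreserving (measurePreserving_eval (fun _ : Fin M => P) j)
    have hX : MemLp X 2 (Measure.pi fun _ : Fin M => P) := memLp_finsetSum' _ fun j _ => hfj j
    have hEX : ∫ ω, X ω ∂(Measure.pi fun _ : Fin M => P) = M * P.real A := by
      simp only [hXapp]
      rw [integral_finsetSum _ fun j _ => (hfj j).integrable (by norm_num)]
      have : ∀ j : Fin M, ∫ ω, f (ω j) ∂(Measure.pi fun _ : Fin M => P) = P.real A := by
        intro j
        rw [integral_comp_eval (μ := fun _ : Fin M => P) (i := j) hf.1]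
        exact integral_indicator_one hA
      simp [this]
    have hVX : Var[X; Measure.pi fun _ : Fin M => P] ≤ M := by
      rw [variance_sum_pi (μ := fun _ : Fin M => P) (X := fun _ => f) fun _ => hf]
      simpa using mul_le_mul_of_nonneg_left hvar hM'.le
    have hcheb := meas_ge_le_variance_div_sq hX (mul_pos hM' hcpos)
    rw [hEX] at hcheb
    have hsmall : Var[X; Measure.pi fun _ : Fin M => P] / (M * c) ^ 2 ≤ 1 / (c ^ 2 * M) := by
      calc _ ≤ (M : ℝ) / (M * c) ^ 2 := by gcongr
        _ = _ := by field_simp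
    have hcompl : {ω : Fin M → S | ⌈ε * M⌉₊ ≤ #{j | ω j ∈ A}}ᶜ ⊆
        {ω | M * c ≤ |X ω - M * P.real A|} := by
      intro ω hω
      simp only [Set.mem_compl_iff, Set.mem_ofPred_eq, not_le, Nat.lt_ceil, hcount, ← hXapp] at hω
      simp only [Set.mem_ofPred_eq]
      rw [abs_sub_comm]
      refine le_trans ?_ (le_abs_self _)
      rw [hc]
      nlinarith
    have h1 : (1 : ENNReal) ≤ Measure.pi (fun _ : Fin M => P)
        {ω | ⌈ε * M⌉₊ ≤ #{j | ω j ∈ A}} + ENNReal.ofReal (1 / (c ^ 2 * M)) := by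
      rw [← measure_univ (μ := Measure.pi fun _ : Fin M => P), ← Set.union_compl_self
        {ω : Fin M → S | ⌈ε * M⌉₊ ≤ #{j | ω j ∈ A}}]
      refine (measure_union_le _ _).trans (add_le_add le_rfl ?_)
      exact (measure_mono hcompl).trans (hcheb.trans (ENNReal.ofReal_le_ofReal hsmall))
    exact tsub_le_iff_right.2 h1
  have hlim : Tendsto (fun M : ℕ => 1 - ENNReal.ofReal (1 / (c ^ 2 * M))) atTop (𝓝 1) := by
    have h0 : Tendsto (fun M : ℕ => 1 / (c ^ 2 * (M : ℝ))) atTop (𝓝 0) := by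
      have := (tendsto_const_div_atTop_nhds_zero_nat (1 / c ^ 2))
      refine this.congr fun M => ?_
      rw [div_div]
    have h1 := ENNReal.tendsto_ofReal h0
    rw [ENNReal.ofReal_zero] at h1
    simpa using ENNReal.Tendsto.sub (tendsto_const_nhds (x := (1 : ENNReal))) h1
      (Or.inl ENNReal.one_ne_top)
  refine tendsto_of_tendsto_of_tendsto_of_le_of_le' hlim tendsto_const_nhds ?_
    (Eventually.of_forall fun M => prob_le_one)
  filter_upwards [eventually_gt_atTop 0] with M hM using hbound M hM

end LawOfLargeNumbers

section Scenario

/-! ### The scenario bound for convex programs -/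

open Finset Filter Topology

variable {S E : Type*} [MeasurableSpace S] [NormedAddCommGroup E] [NormedSpace ℝ E]
  [FiniteDimensional ℝ E] [MeasurableSpace E] [BorelSpace E]

open Classical in
/-- The scenario bound for strictly convex functions on a compact set. Confronting the `N` samples
with `M` further ones, a violation probability above `ε` yields about `ε M` violators, and the
counting bound tends to the binomial tail as `M → ∞`. -/
theorem measure_lt_violationSet_le (P : Measure S) [IsProbabilityMeasure P] {K : Set E}
    {Φ : S → E → ℝ} (h : IsConvexFamily K Φ) (hΦ : ∀ x ∈ K, Measurable fun s => Φ s x) {d N : ℕ}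
    (hd : d = Module.finrank ℝ E + 1) (hN : d ≤ N) {ε : ℝ} (hε0 : 0 ≤ ε) (hε1 : ε ≤ 1) :
    Measure.pi (fun _ : Fin N => P) {ω | ε < P.real (violationSet K Φ ω univ)} ≤
      ENNReal.ofReal (binTail d ε N) := by
  have hne : (univ : Finset (Fin N)).Nonempty :=
    card_pos.1 (by rw [card_univ, Fintype.card_fin]; omega)
  have hW := measurableSet_violation h hΦ hne
  have hB : MeasurableSet {ω : Fin N → S | ε < P.real (violationSet K Φ ω univ)} :=
    measurableSet_lt measurable_const (measurable_measure_prodMk_left (ν := P) hW).ennreal_toReal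
  let Ev : (M : ℕ) → Set ((Fin N → S) × (Fin M → S)) := fun M =>
    {q | ⌈ε * M⌉₊ ≤ #{j | q.2 j ∈ violationSet K Φ q.1 univ}}
  have hEv : ∀ M, MeasurableSet (Ev M) := fun M =>
    measurableSet_le_card _ (fun j => (measurable_fst.prodMk
      ((measurable_pi_apply j).comp measurable_snd)) hW) _
  let f : ℕ → (Fin N → S) → ENNReal := fun M ω =>
    Measure.pi (fun _ : Fin M => P) (Prod.mk ω ⁻¹' Ev M)
  have hf : ∀ M, Measurable (f M) := fun M => measurable_measure_prodMk_left (hEv M)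
  let a : ℕ → ℕ := fun M => ⌈ε * M⌉₊ + d - 1
  have hceil : ∀ M : ℕ, ⌈ε * M⌉₊ ≤ M := fun M =>
    Nat.ceil_le.2 (mul_le_of_le_one_left (Nat.cast_nonneg M) hε1)
  have haN : ∀ M, a M ≤ N + M := fun M => by
    have := hceil M
    simp only [a]
    omega
  have ha : Tendsto (fun M => (a M : ℝ) / M) atTop (𝓝 ε) := by
    have h1 : Tendsto (fun M : ℕ => ((⌈ε * M⌉₊ : ℕ) : ℝ) / M) atTop (𝓝 ε) :=
      (tendsto_nat_ceil_mul_div_atTop hε0).comp tendsto_natCast_atTop_atTop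
    have h2 : Tendsto (fun M : ℕ => ((d - 1 : ℕ) : ℝ) / M) atTop (𝓝 0) :=
      tendsto_const_div_atTop_nhds_zero_nat _
    have h3 := h1.add h2
    rw [add_zero] at h3
    refine h3.congr fun M => ?_
    rw [← add_div, ← Nat.cast_add]
    congr 2
    simp only [a]
    omega
  have hint : ∀ M, ∫⁻ ω, f M ω ∂(Measure.pi fun _ : Fin N => P) ≤
      ENNReal.ofReal ((∑ i ∈ range d, ((a M).choose i : ℝ) * (N + M - a M).choose (N - i)) /
        (N + M).choose N) := by
    intro M
    have hmp := measurePreserving_sumPiEquivProdPi (X := fun _ : Fin N ⊕ Fin M => S) (fun _ => P)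
    rw [← Measure.prod_apply (hEv M), ← hmp.measure_preimage_equiv (Ev M)]
    have hbound := measure_le_card_violators_le h hΦ (H := Fin N ⊕ Fin M) P hd hN
      (k := ⌈ε * M⌉₊) (by
        rw [Fintype.card_sum, Fintype.card_fin, Fintype.card_fin]
        exact haN M) ((univ : Finset (Fin N)).map .inl) (by simp)
    simp only [Fintype.card_sum, Fintype.card_fin] at hbound
    refine (measure_mono fun ω hω => ?_).trans hbound
    simp only [Ev, Set.mem_preimage, Set.mem_ofPred_eq, violationSet_map] at hω ⊢
    refine hω.trans (card_le_card_of_injOn Sum.inr (fun j hj => ?_)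
      Sum.inr_injective.injOn)
    exact mem_filter.2 ⟨mem_univ _, (mem_filter.1 hj).2⟩
  have hlim := ENNReal.tendsto_ofReal (tendsto_hypergeometric hN ha haN)
  calc _ = ∫⁻ ω, {ω : Fin N → S | ε < P.real (violationSet K Φ ω univ)}.indicator 1 ω
          ∂(Measure.pi fun _ : Fin N => P) := (lintegral_indicator_one hB).symm
    _ ≤ ∫⁻ ω, liminf (fun M => f M ω) atTop ∂(Measure.pi fun _ : Fin N => P) := by
        refine lintegral_mono fun ω => ?_
        by_cases hω : ε < P.real (violationSet K Φ ω univ)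
        · have := (tendsto_measure_ceil_le_card P (A := violationSet K Φ ω univ)
            (measurable_prodMk_left hW) hω).liminf_eq
          rw [Set.indicator_of_mem (by exact hω)]
          exact this.ge
        · rw [Set.indicator_of_notMem (by exact hω)]
          exact zero_le
    _ ≤ liminf (fun M => ∫⁻ ω, f M ω ∂(Measure.pi fun _ : Fin N => P)) atTop :=
        lintegral_liminf_le hf
    _ ≤ liminf (fun M => ENNReal.ofReal ((∑ i ∈ range d, ((a M).choose i : ℝ) *
          (N + M - a M).choose (N - i)) / (N + M).choose N)) atTop :=
        liminf_le_liminf (Eventually.of_forall hint)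
    _ = _ := hlim.liminf_eq

lemma measure_le_of_eventually_mem {Ω : Type*} [MeasurableSpace Ω] {μ : Measure Ω} {B : Set Ω}
    {A : ℕ → Set Ω} {c : ENNReal} (hB : ∀ ω ∈ B, ∀ᶠ m in atTop, ω ∈ A m) (hA : ∀ m, μ (A m) ≤ c) :
    μ B ≤ c := by
  have hmono : Monotone fun n : ℕ => ⋂ m ≥ n, A m := fun n n' hnn' =>
    Set.biInter_subset_biInter_left fun m hm => le_trans hnn' hm
  have hsub : B ⊆ ⋃ n : ℕ, ⋂ m ≥ n, A m := fun ω hω => by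
    obtain ⟨n, hn⟩ := eventually_atTop.1 (hB ω hω)
    exact Set.mem_iUnion.2 ⟨n, Set.mem_iInter₂.2 hn⟩
  refine (measure_mono hsub).trans ?_
  rw [hmono.measure_iUnion]
  exact iSup_le fun n => (measure_mono (Set.biInter_subset_of_mem (le_refl n))).trans (hA n)

lemma eventually_lt_measureReal {S : Type*} [MeasurableSpace S] {P : Measure S}
    [IsFiniteMeasure P] {B : Set S} {A : ℕ → Set S} (hB : ∀ s ∈ B, ∀ᶠ m in atTop, s ∈ A m) {c : ℝ}
    (hc : c < P.real B) : ∀ᶠ m in atTop, c < P.real (A m) := by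
  have hmono : Monotone fun n : ℕ => ⋂ m ≥ n, A m := fun n n' hnn' =>
    Set.biInter_subset_biInter_left fun m hm => le_trans hnn' hm
  have hsub : B ⊆ ⋃ n : ℕ, ⋂ m ≥ n, A m := fun ω hω => by
    obtain ⟨n, hn⟩ := eventually_atTop.1 (hB ω hω)
    exact Set.mem_iUnion.2 ⟨n, Set.mem_iInter₂.2 hn⟩
  have hlim := (ENNReal.tendsto_toReal (measure_ne_top P _)).comp
    (tendsto_measure_iUnion_atTop (μ := P) hmono)
  have hc' : c < (P (⋃ n : ℕ, ⋂ m ≥ n, A m)).toReal := hc.trans_le (measureReal_mono hsub)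
  filter_upwards [hlim.eventually (lt_mem_nhds hc')] with n hn
  exact hn.trans_le (measureReal_mono (Set.biInter_subset_of_mem (le_refl n)))

/-- `x` solves, with value `ξ`, the program to minimize `max (f i x)` over the points of `Dom`,
where `τ` decides between several minimizers. -/
structure IsLexSolution {ι E : Type*} (Dom : Set E) (f : ι → E → ℝ) (τ : E → ℝ) (x : E) (ξ : ℝ) :
    Prop where
  mem : x ∈ Dom
  le : ∀ i, f i x ≤ ξ
  min : ∀ y ∈ Dom, ∀ ξ', (∀ i, f i y ≤ ξ') → ξ ≤ ξ'
  tie : ∀ y ∈ Dom, (∀ i, f i y ≤ ξ) → τ x ≤ τ y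

lemma sup'_add_right {ι : Type*} {R : Finset ι} (hR : R.Nonempty) (f : ι → ℝ) (c : ℝ) :
    (R.sup' hR fun i => f i + c) = R.sup' hR f + c := by
  refine le_antisymm (sup'_le _ _ fun i hi => add_le_add_left (le_sup' f hi) c) ?_
  obtain ⟨i, hi, heq⟩ := exists_mem_eq_sup' hR f
  rw [heq]
  exact le_sup' (fun i => f i + c) hi

omit [FiniteDimensional ℝ E] [MeasurableSpace E] [BorelSpace E] in
lemma isConvexFamily_add_smul {ι : Type*} {K : Set E} (hK : IsCompact K) (hne : K.Nonempty)
    (hKc : Convex ℝ K) {f : ι → E → ℝ} (hf : ∀ i, ConvexOn ℝ Set.univ (f i))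
    (hfc : ∀ i, Continuous (f i)) {τ : E → ℝ} (hτ : StrictConvexOn ℝ Set.univ τ)
    (hτc : Continuous τ) {δ : ℝ} (hδ : 0 < δ) : IsConvexFamily K fun i x => f i x + δ * τ x where
  compact := hK
  nonempty := hne
  convex i := by
    refine ((hf i).subset (Set.subset_univ K) hKc).add_strictConvexOn ⟨hKc, ?_⟩
    intro x _ y _ hxy a b ha hb hab
    have := hτ.2 (Set.mem_univ x) (Set.mem_univ y) hxy ha hb hab
    simp only [smul_eq_mul] at this ⊢
    nlinarith
  cont i := ((hfc i).add (continuous_const.mul hτc)).continuousOn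

omit [FiniteDimensional ℝ E] [MeasurableSpace E] [BorelSpace E] in
/-- As `δ → 0`, the minimizer of `max (f i) + δ τ` tends to the solution that `τ` selects among the
minimizers of `max (f i)`. -/
lemma IsLexSolution.tendsto_minimizer {ι : Type*} [Fintype ι] {K : Set E} (hK : IsCompact K)
    (hKc : Convex ℝ K) {f : ι → E → ℝ} (hf : ∀ i, ConvexOn ℝ Set.univ (f i))
    (hfc : ∀ i, Continuous (f i)) {τ : E → ℝ} (hτ : StrictConvexOn ℝ Set.univ τ)
    (hτc : Continuous τ) (hι : (univ : Finset ι).Nonempty) {x : E} {ξ : ℝ}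
    (hx : IsLexSolution K f τ x ξ) {δ : ℕ → ℝ} (hδ : ∀ j, 0 < δ j)
    (hδ0 : Tendsto δ atTop (𝓝 0)) :
    Tendsto (fun j => minimizer K (fun i x => f i x + δ j * τ x) univ) atTop (𝓝 x) := by
  have hne : K.Nonempty := ⟨x, hx.mem⟩
  have hfam := fun j => isConvexFamily_add_smul hK hne hKc hf hfc hτ hτc (hδ j)
  have hmem := fun j => (hfam j).minimizer_mem univ
  set u := fun j => minimizer K (fun i x => f i x + δ j * τ x) univ with hu
  let F : E → ℝ := fun y => univ.sup' hι fun i => f i y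
  have hF : Continuous F := Continuous.finset_sup'_apply hι fun i _ => hfc i
  have hle : ∀ y, ∀ i, f i y ≤ F y := fun y i => le_sup' (fun i => f i y) (mem_univ i)
  have hFx : F x ≤ ξ := sup'_le _ _ fun i _ => hx.le i
  have hcmp : ∀ j, F (u j) + δ j * τ (u j) ≤ F x + δ j * τ x := by
    intro j
    have := (hfam j).minVal_le univ hx.mem
    rw [minVal, maxOn_eq_coe_sup' _ hι, maxOn_eq_coe_sup' _ hι, WithBot.coe_le_coe,
      sup'_add_right hι (fun i => f i _), sup'_add_right hι (fun i => f i _)] at this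
    exact this
  obtain ⟨x₀, -, hx₀⟩ := hK.exists_isMinOn hne hτc.continuousOn
  refine hK.tendsto_nhds_of_unique_mapClusterPt (Eventually.of_forall hmem) fun y hy hcl => ?_
  have hFy : F y ≤ ξ := by
    refine le_of_mapClusterPt hF.continuousOn (Eventually.of_forall hmem) hy hcl
      (g := fun j => ξ + δ j * (τ x - τ x₀)) ?_ (Eventually.of_forall fun j => ?_)
    · simpa using (hδ0.mul_const (τ x - τ x₀)).const_add ξ
    · have h1 := hcmp j
      have h2 : τ x₀ ≤ τ (u j) := hx₀ (hmem j)
      have h3 := mul_le_mul_of_nonneg_left h2 (hδ j).le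
      linarith
  have hτy : τ y ≤ τ x := by
    refine le_of_mapClusterPt hτc.continuousOn (Eventually.of_forall hmem) hy hcl
      (g := fun _ => τ x) tendsto_const_nhds (Eventually.of_forall fun j => ?_)
    have h1 := hcmp j
    have h2 := hx.min _ (hmem j) _ (hle (u j))
    exact le_of_mul_le_mul_left (by linarith) (hδ j)
  by_contra hyx
  -- Otherwise the midpoint would be a feasible point with a smaller tie-break value.
  have hmid : (1 / 2 : ℝ) • y + (1 / 2 : ℝ) • x ∈ K :=
    hKc hy hx.mem (one_half_pos (α := ℝ)).le (one_half_pos (α := ℝ)).le (add_halves 1)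
  have h1 := hx.tie _ hmid fun i => by
    have h2 := (hf i).2 (Set.mem_univ y) (Set.mem_univ x) (one_half_pos (α := ℝ)).le
      (one_half_pos (α := ℝ)).le (add_halves 1)
    have h3 := hx.le i
    have h4 := (hle y i).trans hFy
    simp only [smul_eq_mul] at h2
    linarith
  have h2 := hτ.2 (Set.mem_univ y) (Set.mem_univ x) hyx (one_half_pos (α := ℝ))
    (one_half_pos (α := ℝ)) (add_halves 1)
  simp only [smul_eq_mul] at h2
  linarith

omit [FiniteDimensional ℝ E] [MeasurableSpace E] [BorelSpace E] in
lemma eventually_lt_violationSet (P : Measure S) [IsFiniteMeasure P] {K : Set E}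
    (hK : IsCompact K) (hKc : Convex ℝ K) {f : S → E → ℝ} (hf : ∀ s, ConvexOn ℝ Set.univ (f s))
    (hfc : ∀ s, Continuous (f s)) {τ : E → ℝ} (hτ : StrictConvexOn ℝ Set.univ τ) (hτc : Continuous τ)
    {ι : Type*} [Fintype ι] (hι : (univ : Finset ι).Nonempty) (ω : ι → S) {x : E} {ξ : ℝ}
    (hx : IsLexSolution K (fun i => f (ω i)) τ x ξ) {ε : ℝ} (hε : ε < P.real {s | ξ < f s x})
    {δ : ℕ → ℝ} (hδ : ∀ j, 0 < δ j) (hδ0 : Tendsto δ atTop (𝓝 0)) :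
    ∀ᶠ j in atTop, ε < P.real (violationSet K (fun s x => f s x + δ j * τ x) ω univ) := by
  refine eventually_lt_measureReal (fun s hs => ?_) hε
  have hlim := hx.tendsto_minimizer hK hKc (fun i => hf (ω i)) (fun i => hfc (ω i)) hτ hτc hι hδ hδ0
  have hF : Continuous fun y => univ.sup' hι fun i => f (ω i) y :=
    Continuous.finset_sup'_apply hι fun i _ => hfc (ω i)
  have hFx : (univ.sup' hι fun i => f (ω i) x) ≤ ξ := sup'_le _ _ fun i _ => hx.le i
  have := ((hF.tendsto x).comp hlim).eventually_lt (((hfc s).tendsto x).comp hlim)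
    (hFx.trans_lt hs)
  filter_upwards [this] with j hj
  rw [mem_violationSet_iff hι, sup'_add_right hι (fun i => f (ω i) _)]
  exact add_lt_add_left hj _

/-- The scenario bound for a convex program whose domain is exhausted by compact sets and whose
solution is selected by a strictly convex tie-break function: the probability that the program has a
solution whose violation probability is at least `ε` is at most the binomial tail. -/
theorem measure_isLexSolution_le (P : Measure S) [IsProbabilityMeasure P] {K : ℕ → Set E}
    (hK : ∀ m, IsCompact (K m)) (hKc : ∀ m, Convex ℝ (K m)) (hKmono : Monotone K)
    {f : S → E → ℝ} (hf : ∀ s, ConvexOn ℝ Set.univ (f s))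
    (hfm : ∀ m, ∀ x ∈ K m, Measurable fun s => f s x)
    {τ : E → ℝ} (hτ : StrictConvexOn ℝ Set.univ τ) {d N : ℕ} (hd : d = Module.finrank ℝ E + 1)
    (hN : d ≤ N) {ε : ℝ} (hε0 : 0 < ε) (hε1 : ε ≤ 1) :
    Measure.pi (fun _ : Fin N => P) {ω | ∃ x ξ,
        IsLexSolution (⋃ m, K m) (fun i => f (ω i)) τ x ξ ∧ ε ≤ P.real {s | ξ < f s x}} ≤
      ENNReal.ofReal (binTail d ε N) := by
  have hι : (univ : Finset (Fin N)).Nonempty :=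
    card_pos.1 (by rw [card_univ, Fintype.card_fin]; omega)
  have hfc : ∀ s, Continuous (f s) := fun s =>
    continuousOn_univ.1 ((hf s).continuousOn isOpen_univ)
  have hτc : Continuous τ := continuousOn_univ.1 (hτ.convexOn.continuousOn isOpen_univ)
  have hcont : Tendsto (fun ε' => ENNReal.ofReal (binTail d ε' N)) (𝓝[<] ε)
      (𝓝 (ENNReal.ofReal (binTail d ε N))) := by
    have : Continuous fun ε' => ENNReal.ofReal (binTail d ε' N) := by
      unfold binTail
      exact ENNReal.continuous_ofReal.comp (by fun_prop)
    exact (this.tendsto ε).mono_left nhdsWithin_le_nhds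
  refine ge_of_tendsto hcont ?_
  filter_upwards [Ioo_mem_nhdsLT hε0] with ε' hε'
  let δ : ℕ → ℝ := fun j => 1 / ((j : ℝ) + 1)
  have hδ : ∀ j, 0 < δ j := fun j => by positivity
  have hδ0 : Tendsto δ atTop (𝓝 0) := tendsto_one_div_add_atTop_nhds_zero_nat
  let A : ℕ → ℕ → Set (Fin N → S) := fun m j => {ω | (K m).Nonempty ∧
    ε' < P.real (violationSet (K m) (fun s x => f s x + δ j * τ x) ω univ)}
  refine measure_le_of_eventually_mem (A := fun m => {ω | ∀ᶠ j in atTop, ω ∈ A m j}) ?_ fun m =>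
    measure_le_of_eventually_mem (A := A m) (fun ω hω => hω) fun j => ?_
  · rintro ω ⟨x, ξ, hx, hxε⟩
    obtain ⟨m₀, hm₀⟩ := Set.mem_iUnion.1 hx.mem
    filter_upwards [eventually_ge_atTop m₀] with m hm
    have hxm : IsLexSolution (K m) (fun i => f (ω i)) τ x ξ :=
      ⟨hKmono hm hm₀, hx.le, fun y hy => hx.min y (Set.mem_iUnion_of_mem m hy),
        fun y hy => hx.tie y (Set.mem_iUnion_of_mem m hy)⟩
    filter_upwards [eventually_lt_violationSet P (hK m) (hKc m) hf hfc hτ hτc hι ω hxm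
      (hε'.2.trans_le hxε) hδ hδ0] with j hj
    exact ⟨⟨x, hxm.mem⟩, hj⟩
  · by_cases hne : (K m).Nonempty
    · refine (measure_mono fun ω hω => hω.2).trans (measure_lt_violationSet_le P
        (isConvexFamily_add_smul (hK m) hne (hKc m) hf hfc hτ hτc (hδ j)) (fun x hx => ?_) hd hN
        hε'.1.le (hε'.2.le.trans hε1))
      exact (hfm m x hx).add_const _
    · have : A m j = ∅ := Set.eq_empty_of_forall_notMem fun ω hω => hne hω.1
      rw [this, measure_empty]
      exact zero_le

end Scenario

section Application

/-! ### Alternating pseudo-bisimulation functions -/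

open Finset Filter Topology

variable {n m p z : ℕ} {Ξ : ControlSystem n m p} {σ : ℝ} (A : SymbolicAbstraction Ξ σ)
  (g : Fin z → Vec n → Vec n → ℝ)

lemma candidate_combo (φ φ' : Fin z → ℝ) (a b : ℝ) (x xh : Vec n) :
    candidate g (a • φ + b • φ') x xh = a * candidate g φ x xh + b * candidate g φ' x xh := by
  simp only [candidate, mul_sum, ← sum_add_distrib, Pi.add_apply, Pi.smul_apply, smul_eq_mul]
  exact sum_congr rfl fun j _ => by ring

lemma H1_combo (G G' : Decision z) (a b : ℝ) (x xh : Vec n) :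
    H1 g (a • G + b • G') x xh = a * H1 g G x xh + b * H1 g G' x xh := by
  have hγ : (a • G + b • G').γ = a * G.γ + b * G'.γ := rfl
  have hφ : (a • G + b • G').φ = a • G.φ + b • G'.φ := rfl
  rw [H1, H1, H1, hγ, hφ, candidate_combo]
  ring

lemma H2_combo (μ : ℝ) (G G' : Decision z) (a b : ℝ) (x xh : Vec n) (ν : Vec m) (e eh : Vec p) :
    H2 A g μ (a • G + b • G') x xh ν e eh =
      a * H2 A g μ G x xh ν e eh + b * H2 A g μ G' x xh ν e eh := by
  have hη : (a • G + b • G').η = a * G.η + b * G'.η := rfl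
  have hθ : (a • G + b • G').θ = a * G.θ + b * G'.θ := rfl
  have hφ : (a • G + b • G').φ = a • G.φ + b • G'.φ := rfl
  rw [H2, H2, H2, hη, hθ, hφ, candidate_combo, candidate_combo]
  ring

/-- If `H₁` and `H₂` are nonpositive everywhere, the candidate is an APBF: a sum
`μ S + η ‖d - d̂‖² + θ` with `μ < μ' = (1 + μ) / 2` is at most the maximum of `μ' S` and suitable
multiples of the other two terms. -/
lemma isAPBF_of_nonpos {μ : ℝ} (hμ0 : 0 < μ) (hμ1 : μ < 1) {G : Decision z} (hG : G.Admissible)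
    (h1 : ∀ x ∈ Ξ.X, ∀ xh ∈ A.Xhat, H1 g G x xh ≤ 0)
    (h2 : ∀ x ∈ Ξ.X, ∀ xh ∈ A.Xhat, ∀ ν ∈ Ξ.U, ∀ e ∈ Ξ.D, ∀ eh ∈ A.Dhat,
      H2 A g μ G x xh ν e eh ≤ 0) :
    IsAPBF A (candidate g G.φ) := by
  obtain ⟨hγ, hη, hθ⟩ := hG
  have hlow : ∀ x ∈ Ξ.X, ∀ xh ∈ A.Xhat, G.γ * ‖x - xh‖ ^ 2 ≤ candidate g G.φ x xh :=
    fun x hx xh hxh => by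
      have := h1 x hx xh hxh
      rw [H1] at this
      linarith
  refine ⟨fun x hx xh hxh => le_trans (by positivity) (hlow x hx xh hxh), ?_⟩
  set μ' : ℝ := (1 + μ) / 2 with hμ'
  have hμ'0 : 0 < μ' := by linarith
  have hμμ' : μ < μ' := by linarith
  -- The share of the maximum that is left for each of the terms in `η` and `θ`.
  set c : ℝ := (1 - μ / μ') / 2 with hc
  have hc0 : 0 < c := by
    have : μ / μ' < 1 := (div_lt_one hμ'0).2 hμμ'
    linarith
  refine ⟨G.γ, μ', G.η / c, G.θ / c, hγ, hμ'0, by linarith, by positivity, by positivity, hlow, ?_⟩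
  intro x hx xh hxh ν hν e he eh heh
  have := h2 x hx xh hxh ν hν e he eh heh
  rw [H2] at this
  set M := max (μ' * candidate g G.φ x xh) (max (G.η / c * ‖e - eh‖ ^ 2) (G.θ / c)) with hM
  have hM1 : μ' * candidate g G.φ x xh ≤ M := le_max_left _ _
  have hM2 : G.η / c * ‖e - eh‖ ^ 2 ≤ M := (le_max_left _ _).trans (le_max_right _ _)
  have hM3 : G.θ / c ≤ M := (le_max_right _ _).trans (le_max_right _ _)
  have e1 : μ * candidate g G.φ x xh ≤ μ / μ' * M := by
    calc μ * candidate g G.φ x xh = μ / μ' * (μ' * candidate g G.φ x xh) := by field_simp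
      _ ≤ _ := by gcongr
  have e2 : G.η * ‖e - eh‖ ^ 2 ≤ c * M := by
    calc G.η * ‖e - eh‖ ^ 2 = c * (G.η / c * ‖e - eh‖ ^ 2) := by field_simp
      _ ≤ _ := by gcongr
  have e3 : G.θ ≤ c * M := by
    calc G.θ = c * (G.θ / c) := by field_simp
      _ ≤ _ := by gcongr
  have hsum : μ / μ' * M + c * M + c * M = M := by
    rw [hc]
    ring
  linarith

/-- The indices `(x̂, d̂, ν)` of the constraints that each sample contributes. -/
def constraintIndex : Finset (Vec n × Vec p × Vec m) := A.Xhat ×ˢ A.Dhat ×ˢ Ξ.U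

open Classical in
/-- The largest of the values of `H₁` and `H₂` at the sample `s`. Off `X × D`, where the constraint
functions need not be measurable, it is set to `0`. -/
noncomputable def worstCase (hJ : (constraintIndex A).Nonempty) (μ : ℝ) (s : Vec n × Vec p)
    (G : Decision z) : ℝ :=
  if s ∈ Ξ.X ×ˢ Ξ.D then
    (constraintIndex A).sup' hJ fun j =>
      max (H1 g G s.1 j.1) (H2 A g μ G s.1 j.1 j.2.2 s.2 j.2.1)
  else 0

variable (hJ : (constraintIndex A).Nonempty)

lemma worstCase_le_iff {μ : ℝ} {s : Vec n × Vec p} (hs : s ∈ Ξ.X ×ˢ Ξ.D) {G : Decision z} {ξ : ℝ} :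
    worstCase A g hJ μ s G ≤ ξ ↔ ∀ xh ∈ A.Xhat, ∀ eh ∈ A.Dhat, ∀ ν ∈ Ξ.U,
      max (H1 g G s.1 xh) (H2 A g μ G s.1 xh ν s.2 eh) ≤ ξ := by
  rw [worstCase, if_pos hs, sup'_le_iff]
  simp only [constraintIndex, mem_product, Prod.forall, and_imp]
  exact ⟨fun h xh hxh eh heh ν hν => h xh eh ν hxh heh hν,
    fun h xh eh ν hxh heh hν => h xh hxh eh heh ν hν⟩

lemma convexOn_worstCase (μ : ℝ) (s : Vec n × Vec p) :
    ConvexOn ℝ Set.univ (worstCase A g hJ μ s) := by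
  refine ⟨convex_univ, fun G _ G' _ a b ha hb _ => ?_⟩
  by_cases hs : s ∈ Ξ.X ×ˢ Ξ.D
  · simp only [worstCase, if_pos hs, smul_eq_mul]
    refine sup'_le _ _ fun j hj => ?_
    have h1 := le_sup' (fun j => max (H1 g G s.1 j.1) (H2 A g μ G s.1 j.1 j.2.2 s.2 j.2.1)) hj
    have h2 := le_sup' (fun j => max (H1 g G' s.1 j.1) (H2 A g μ G' s.1 j.1 j.2.2 s.2 j.2.1)) hj
    rw [H1_combo, H2_combo]
    refine max_le (add_le_add ?_ ?_) (add_le_add ?_ ?_)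
    · exact mul_le_mul_of_nonneg_left ((le_max_left _ _).trans h1) ha
    · exact mul_le_mul_of_nonneg_left ((le_max_left _ _).trans h2) hb
    · exact mul_le_mul_of_nonneg_left ((le_max_right _ _).trans h1) ha
    · exact mul_le_mul_of_nonneg_left ((le_max_right _ _).trans h2) hb
  · simp [worstCase, if_neg hs]

lemma measurable_worstCase (hX : IsCompact Ξ.X) (hD : IsCompact Ξ.D) {μ : ℝ} {G : Decision z}
    (h1 : ∀ xh ∈ A.Xhat, ContinuousOn (fun x => H1 g G x xh) Ξ.X)
    (h2 : ∀ xh ∈ A.Xhat, ∀ ν ∈ Ξ.U, ∀ eh ∈ A.Dhat,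
      ContinuousOn (fun q : Vec n × Vec p => H2 A g μ G q.1 xh ν q.2 eh) (Ξ.X ×ˢ Ξ.D)) :
    Measurable fun s => worstCase A g hJ μ s G := by
  classical
  have hcont : ContinuousOn (fun s : Vec n × Vec p => (constraintIndex A).sup' hJ fun j =>
      max (H1 g G s.1 j.1) (H2 A g μ G s.1 j.1 j.2.2 s.2 j.2.1)) (Ξ.X ×ˢ Ξ.D) := by
    refine ContinuousOn.finset_sup'_apply hJ fun j hj => ?_
    simp only [constraintIndex, mem_product] at hj
    exact ((h1 j.1 hj.1).comp continuousOn_fst fun s hs => hs.1).sup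
      (h2 j.1 hj.1 j.2.2 hj.2.2 j.2.1 hj.2.1)
  have := hcont.measurable_piecewise (continuousOn_const (c := (0 : ℝ)))
    (hX.isClosed.prod hD.isClosed).measurableSet
  convert this using 2 with s
  by_cases hs : s ∈ Ξ.X ×ˢ Ξ.D
  · rw [Set.piecewise_eq_of_mem _ _ _ hs, worstCase, if_pos hs]
  · rw [Set.piecewise_eq_of_notMem _ _ _ hs, worstCase, if_neg hs]

/-- An exhaustion of the admissible decisions in `C` by compact convex sets. -/
def admissibleExhaustion (C : Set (Decision z)) (k : ℕ) : Set (Decision z) :=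
  (C ∩ {G | 1 / ((k : ℝ) + 1) ≤ G.γ ∧ 0 ≤ G.η ∧ 0 ≤ G.θ}) ∩ Metric.closedBall 0 k

lemma isCompact_admissibleExhaustion {C : Set (Decision z)} (hC : IsClosed C) (k : ℕ) :
    IsCompact (admissibleExhaustion C k) := by
  refine (isCompact_closedBall _ _).inter_left (hC.inter ?_)
  have h1 : Continuous fun G : Decision z => G.γ := continuous_fst
  have h2 : Continuous fun G : Decision z => G.η := continuous_fst.comp continuous_snd
  have h3 : Continuous fun G : Decision z => G.θ :=
    continuous_fst.comp (continuous_snd.comp continuous_snd)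
  exact (isClosed_le continuous_const h1).inter
    ((isClosed_le continuous_const h2).inter (isClosed_le continuous_const h3))

lemma convex_admissibleExhaustion {C : Set (Decision z)} (hC : Convex ℝ C) (k : ℕ) :
    Convex ℝ (admissibleExhaustion C k) := by
  refine (hC.inter ?_).inter (convex_closedBall _ _)
  rintro G ⟨h1, h2, h3⟩ G' ⟨h1', h2', h3'⟩ a b ha hb hab
  have hγ : (a • G + b • G').γ = a * G.γ + b * G'.γ := rfl
  have hη : (a • G + b • G').η = a * G.η + b * G'.η := rfl
  have hθ : (a • G + b • G').θ = a * G.θ + b * G'.θ := rfl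
  refine ⟨?_, ?_, ?_⟩
  · rw [hγ]
    calc 1 / ((k : ℝ) + 1) = a * (1 / ((k : ℝ) + 1)) + b * (1 / ((k : ℝ) + 1)) := by
          rw [← add_mul, hab, one_mul]
      _ ≤ _ := by gcongr
  · rw [hη]
    positivity
  · rw [hθ]
    positivity

lemma monotone_admissibleExhaustion (C : Set (Decision z)) :
    Monotone (admissibleExhaustion C) := by
  rintro k k' hkk' G ⟨⟨hC, h1, h2, h3⟩, hball⟩
  have hkk : (k : ℝ) ≤ k' := by exact_mod_cast hkk'
  refine ⟨⟨hC, le_trans ?_ h1, h2, h3⟩, Metric.closedBall_subset_closedBall hkk hball⟩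
  gcongr

lemma iUnion_admissibleExhaustion (C : Set (Decision z)) :
    ⋃ k, admissibleExhaustion C k = {G | G.Admissible ∧ G ∈ C} := by
  ext G
  simp only [Set.mem_iUnion, Set.mem_ofPred_eq]
  constructor
  · rintro ⟨k, ⟨hC, h1, h2, h3⟩, -⟩
    exact ⟨⟨lt_of_lt_of_le (by positivity) h1, h2, h3⟩, hC⟩
  · rintro ⟨⟨h1, h2, h3⟩, hC⟩
    obtain ⟨k₁, hk₁⟩ := exists_nat_one_div_lt h1
    obtain ⟨k₂, hk₂⟩ := exists_nat_ge ‖G‖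
    refine ⟨max k₁ k₂, ⟨hC, le_trans ?_ hk₁.le, h2, h3⟩, ?_⟩
    · gcongr
      exact le_max_left _ _
    · rw [mem_closedBall_zero_iff]
      exact hk₂.trans (by exact_mod_cast le_max_right _ _)

lemma sopFeasible_iff {Q : ℕ} {C : Set (Decision z)} {ω : Fin Q → Vec n × Vec p}
    (hω : ∀ i, ω i ∈ Ξ.X ×ˢ Ξ.D) {μ : ℝ} {G : Decision z} {ξ : ℝ} :
    SOPFeasible A g C ω μ G ξ ↔
      G ∈ ⋃ k, admissibleExhaustion C k ∧ ∀ i, worstCase A g hJ μ (ω i) G ≤ ξ := by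
  rw [iUnion_admissibleExhaustion, SOPFeasible, Set.mem_ofPred_eq, and_assoc]
  simp only [worstCase_le_iff A g hJ (hω _)]

/-- A solution of the scenario program solves the program for its own `μ̃`. -/
lemma IsSOPSolution.isLexSolution {Q l : ℕ} {C : Set (Decision z)} {τ : Decision z → ℝ}
    {μ : Fin l → ℝ} {ω : Fin Q → Vec n × Vec p} (hω : ∀ i, ω i ∈ Ξ.X ×ˢ Ξ.D) {t : Fin l}
    {G : Decision z} {ξ : ℝ} (h : IsSOPSolution A g C τ μ ω t G ξ) :
    IsLexSolution (⋃ k, admissibleExhaustion C k) (fun i => worstCase A g hJ (μ t) (ω i)) τ G ξ := by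
  obtain ⟨h1, h2, h3⟩ := h
  have h1' := (sopFeasible_iff A g hJ hω).1 h1
  exact ⟨h1'.1, h1'.2, fun y hy ξ' hξ' => h2 t y ξ' ((sopFeasible_iff A g hJ hω).2 ⟨hy, hξ'⟩),
    fun y hy hξ => h3 y ((sopFeasible_iff A g hJ hω).2 ⟨hy, hξ⟩)⟩

/-- If the samples contribute no constraints at all, the value of the scenario program is unbounded
below. -/
lemma IsSOPSolution.constraintIndex_nonempty {Q l : ℕ} {C : Set (Decision z)} {τ : Decision z → ℝ}
    {μ : Fin l → ℝ} {ω : Fin Q → Vec n × Vec p} {t : Fin l} {G : Decision z} {ξ : ℝ}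
    (h : IsSOPSolution A g C τ μ ω t G ξ) : (constraintIndex A).Nonempty := by
  by_contra hemp
  have hfeas : SOPFeasible A g C ω (μ t) G (ξ - 1) := by
    refine ⟨h.1.1, h.1.2.1, fun i xh hxh eh heh ν hν => absurd ⟨(xh, eh, ν), ?_⟩ hemp⟩
    simp [constraintIndex, hxh, heh, hν]
  linarith [h.2.1 t G _ hfeas]

/-- If the violation probability is less than that of every ball of radius `r`, then every point of
`X × D` is within distance `r` of a satisfied constraint, and the Lipschitz bounds carry the
inequality over. -/
lemma isAPBF_of_violation_lt {μ : ℝ} (hμ0 : 0 < μ) (hμ1 : μ < 1) {P : Measure (Vec n × Vec p)}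
    [IsProbabilityMeasure P] (hP : ∀ᵐ s ∂P, s ∈ Ξ.X ×ˢ Ξ.D) {G : Decision z} (hG : G.Admissible)
    {L r : ℝ≥0} (h1 : ∀ xh ∈ A.Xhat, LipschitzOnWith L (fun x => H1 g G x xh) Ξ.X)
    (h2 : ∀ xh ∈ A.Xhat, ∀ ν ∈ Ξ.U, ∀ eh ∈ A.Dhat,
      LipschitzOnWith L (fun q : Vec n × Vec p => H2 A g μ G q.1 xh ν q.2 eh) (Ξ.X ×ˢ Ξ.D))
    {ξ : ℝ} (hξ : ξ + L * r ≤ 0)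
    (hball : ∀ x ∈ Ξ.X, ∀ e ∈ Ξ.D,
      P.real {s | ξ < worstCase A g hJ μ s G} < P.real (Metric.ball (x, e) (r : ℝ))) :
    IsAPBF A (candidate g G.φ) := by
  have hnear : ∀ x ∈ Ξ.X, ∀ e ∈ Ξ.D, ∃ s ∈ Ξ.X ×ˢ Ξ.D, dist (x, e) s ≤ r ∧
      ∀ xh ∈ A.Xhat, ∀ eh ∈ A.Dhat, ∀ ν ∈ Ξ.U,
        max (H1 g G s.1 xh) (H2 A g μ G s.1 xh ν s.2 eh) ≤ ξ := by
    intro x hx e he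
    by_contra! hcon
    refine absurd (hball x hx e he) (not_lt.2 ?_)
    refine ENNReal.toReal_mono (measure_ne_top _ _) (measure_mono_ae ?_)
    filter_upwards [hP] with s hs hsball
    change ξ < worstCase A g hJ μ s G
    rw [← not_le, worstCase_le_iff A g hJ hs]
    push Not
    exact hcon s hs (by rw [dist_comm]; exact (Metric.mem_ball.1 hsball).le)
  obtain ⟨⟨xh₀, eh₀, ν₀⟩, hj₀⟩ := hJ
  simp only [constraintIndex, mem_product] at hj₀
  refine isAPBF_of_nonpos A g hμ0 hμ1 hG (fun x hx xh hxh => ?_)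
    fun x hx xh hxh ν hν e he eh heh => ?_
  · have he₀ := A.Dhat_subset eh₀ hj₀.2.1
    obtain ⟨s, hs, hdist, hsat⟩ := hnear x hx eh₀ he₀
    have hle := (le_max_left _ _).trans (hsat xh hxh eh₀ hj₀.2.1 ν₀ hj₀.2.2)
    have hlip := (h1 xh hxh).dist_le_mul x hx s.1 hs.1
    rw [Real.dist_eq] at hlip
    have hd : dist x s.1 ≤ r := (le_max_left _ _).trans hdist
    have := mul_le_mul_of_nonneg_left hd L.coe_nonneg
    linarith [le_abs_self (H1 g G x xh - H1 g G s.1 xh)]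
  · obtain ⟨s, hs, hdist, hsat⟩ := hnear x hx e he
    have hle := (le_max_right _ _).trans (hsat xh hxh eh heh ν hν)
    have hlip := (h2 xh hxh ν hν eh heh).dist_le_mul (x, e) ⟨hx, he⟩ s hs
    rw [Real.dist_eq] at hlip
    have := mul_le_mul_of_nonneg_left hdist L.coe_nonneg
    linarith [le_abs_self (H2 A g μ G x xh ν e eh - H2 A g μ G s.1 xh ν s.2 eh)]

end Application

end ScenarioBound

open ScenarioBound

theorem theorem2
    {n m p z l : ℕ} [NeZero l] (Ξ : ControlSystem n m p)
    (hX : IsCompact Ξ.X) (hD : IsCompact Ξ.D)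
    (σ : ℝ) (A : SymbolicAbstraction Ξ σ)
    -- basis functions of the candidate, and the finite set of values of `μ̃`
    (g : Fin z → Vec n → Vec n → ℝ)
    (μ : Fin l → ℝ) (hμ : ∀ t, 0 < μ t ∧ μ t < 1)
    -- optional further convex constraints on the decision variables (`Set.univ` for none)
    (C : Set (Decision z)) (hCclosed : IsClosed C) (hCconvex : Convex ℝ C)
    -- tie-break rule between several optimal solutions
    (τ : Decision z → ℝ) (hτ : StrictConvexOn ℝ Set.univ τ)
    -- Lipschitz constants of `H₁` in `x` and of `H₂` in `(x, d)`
    (L1 : Decision z → ℝ≥0) (L2 : Fin l → Decision z → ℝ≥0)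
    (hL1 : ∀ G : Decision z, G.Admissible → G ∈ C → ∀ xh ∈ A.Xhat,
      LipschitzOnWith (L1 G) (fun x => H1 g G x xh) Ξ.X)
    (hL2 : ∀ t, ∀ G : Decision z, G.Admissible → G ∈ C →
      ∀ xh ∈ A.Xhat, ∀ ν ∈ Ξ.U, ∀ dh ∈ A.Dhat,
        LipschitzOnWith (L2 t G) (fun q : Vec n × Vec p => H2 A g (μ t) G q.1 xh ν q.2 dh)
          (Ξ.X ×ˢ Ξ.D))
    -- sampling distribution on `X × D`
    (P : Measure (Vec n × Vec p)) [IsProbabilityMeasure P] (hP : P (Ξ.X ×ˢ Ξ.D) = 1)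
    -- lower bound on the probability of balls, and the radii `ϰ⁻¹(εₜ)`
    (ϰ : ℝ≥0 → ℝ) (hϰ01 : ∀ r, ϰ r ∈ Set.Icc (0 : ℝ) 1)
    (hϰ : ∀ r : ℝ≥0, ∀ x ∈ Ξ.X, ∀ d ∈ Ξ.D, ϰ r ≤ P.real (Metric.ball (x, d) (r : ℝ)))
    (ε : Fin l → ℝ) (hε : ∀ t, ε t ∈ Set.Icc (0 : ℝ) 1)
    (β : ℝ) (hβ : β ∈ Set.Icc (0 : ℝ) 1)
    (r : Fin l → ℝ≥0) (hr : ∀ t, ϰ (r t) = ε t)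
    -- sample size: at least the least `N` allowed by the binomial sum; the `z + 4` real
    -- unknowns are `γ`, `η̃`, `θ̃`, `φ₁, …, φ_z` and `ξ`
    (N Q : ℕ) (hN : IsLeast (sampleSizes (z + 4) ε β) N) (hQ : N ≤ Q)
    -- the solution of the scenario program as a function of the samples
    (tstar : (Fin Q → Vec n × Vec p) → Fin l)
    (Gstar : (Fin Q → Vec n × Vec p) → Decision z)
    (ξstar : (Fin Q → Vec n × Vec p) → ℝ)
    (hsol : ∀ᵐ ω ∂(Measure.pi fun _ : Fin Q => P),
      IsSOPSolution A g C τ μ ω (tstar ω) (Gstar ω) (ξstar ω)) :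
    -- the probability that the criterion holds and `S` is nevertheless not an APBF is at most `β`
    ((Measure.pi fun _ : Fin Q => P)
        {ω | ξstar ω + (⨆ t, max (L1 (Gstar ω) : ℝ) (L2 t (Gstar ω)) * r t) ≤ 0 ∧
          ¬ IsAPBF A (candidate g (Gstar ω).φ)} ≤ ENNReal.ofReal β) ∧
    -- in particular, if the criterion holds, then `S` is an APBF with probability at least `1 - β`
    ((∀ᵐ ω ∂(Measure.pi fun _ : Fin Q => P),
        ξstar ω + (⨆ t, max (L1 (Gstar ω) : ℝ) (L2 t (Gstar ω)) * r t) ≤ 0) →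
      ENNReal.ofReal (1 - β) ≤
        (Measure.pi fun _ : Fin Q => P) {ω | IsAPBF A (candidate g (Gstar ω).φ)}) := by
  classical
  have hSclosed : IsClosed (Ξ.X ×ˢ Ξ.D) := hX.isClosed.prod hD.isClosed
  have hPS : ∀ᵐ s ∂P, s ∈ Ξ.X ×ˢ Ξ.D :=
    (mem_ae_iff_prob_eq_one hSclosed.measurableSet).2 hP
  have hωS : ∀ᵐ ω ∂(Measure.pi fun _ : Fin Q => P), ∀ i, ω i ∈ Ξ.X ×ˢ Ξ.D :=
    ae_all_iff.2 fun i =>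
      (measurePreserving_eval (fun _ : Fin Q => P) i).quasiMeasurePreserving.ae hPS
  obtain ⟨ω₀, hω₀⟩ := hsol.exists
  have hJ : (constraintIndex A).Nonempty := IsSOPSolution.constraintIndex_nonempty A g hω₀
  let Bt : Fin l → Set (Fin Q → Vec n × Vec p) := fun t => {ω | ∃ G ξ,
    IsLexSolution (⋃ k, admissibleExhaustion C k) (fun i => worstCase A g hJ (μ t) (ω i)) τ G ξ ∧
      ε t ≤ P.real {s | ξ < worstCase A g hJ (μ t) s G}}
  have hfin : z + 4 = Module.finrank ℝ (Decision z) + 1 := by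
    simp [Decision, Module.finrank_prod]
    omega
  have hBt : ∀ t, Measure.pi (fun _ : Fin Q => P) (Bt t) ≤
      ENNReal.ofReal (binTail (z + 4) (ε t) Q) := by
    intro t
    rcases lt_or_ge Q (z + 4) with hQz | hQz
    · rw [binTail_eq_one_of_lt hQz, ENNReal.ofReal_one]
      exact prob_le_one
    rcases (hε t).1.eq_or_lt with h0 | h0
    · rw [← h0, binTail_zero (by omega), ENNReal.ofReal_one]
      exact prob_le_one
    refine measure_isLexSolution_le P (isCompact_admissibleExhaustion hCclosed)
      (convex_admissibleExhaustion hCconvex) (monotone_admissibleExhaustion C)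
      (convexOn_worstCase A g hJ (μ t)) (fun k G hG => ?_) hτ hfin hQz h0 (hε t).2
    have hGC : G.Admissible ∧ G ∈ C := by
      have := Set.mem_iUnion_of_mem k hG
      rwa [iUnion_admissibleExhaustion] at this
    exact measurable_worstCase A g hJ hX hD
      (fun xh hxh => (hL1 G hGC.1 hGC.2 xh hxh).continuousOn)
      fun xh hxh ν hν eh heh => (hL2 t G hGC.1 hGC.2 xh hxh ν hν eh heh).continuousOn
  have hbin0 : ∀ t, 0 ≤ binTail (z + 4) (ε t) Q := fun t => by
    have h0 := (hε t).1
    have h1 : 0 ≤ 1 - ε t := by linarith [(hε t).2]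
    exact Finset.sum_nonneg fun i _ => by positivity
  have hfirst : (Measure.pi fun _ : Fin Q => P)
        {ω | ξstar ω + (⨆ t, max (L1 (Gstar ω) : ℝ) (L2 t (Gstar ω)) * r t) ≤ 0 ∧
          ¬ IsAPBF A (candidate g (Gstar ω).φ)} ≤ ENNReal.ofReal β := by
    calc _ ≤ (Measure.pi fun _ : Fin Q => P) (⋃ t, Bt t) := measure_mono_ae ?_
      _ ≤ ∑ t, (Measure.pi fun _ : Fin Q => P) (Bt t) := measure_iUnion_fintype_le _ _
      _ ≤ ∑ t, ENNReal.ofReal (binTail (z + 4) (ε t) Q) := Finset.sum_le_sum fun t _ => hBt t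
      _ = ENNReal.ofReal (∑ t, binTail (z + 4) (ε t) Q) :=
          (ENNReal.ofReal_sum_of_nonneg fun t _ => hbin0 t).symm
      _ ≤ ENNReal.ofReal β := ENNReal.ofReal_le_ofReal ?_
    · filter_upwards [hsol, hωS] with ω hω hωi hbad
      obtain ⟨hcrit, hnot⟩ := hbad
      set t := tstar ω
      set G := Gstar ω
      refine Set.mem_iUnion.2 ⟨t, G, ξstar ω,
        IsSOPSolution.isLexSolution A g hJ hωi hω, ?_⟩
      by_contra! hlt
      have hLr : max (L1 G : ℝ) (L2 t G) * r t ≤ ⨆ t, max (L1 G : ℝ) (L2 t G) * r t :=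
        le_ciSup (f := fun t => max (L1 G : ℝ) (L2 t G) * r t) (Set.finite_range _).bddAbove t
      refine hnot (isAPBF_of_violation_lt A g hJ (hμ t).1 (hμ t).2 hPS hω.1.1
        (L := max (L1 G) (L2 t G)) (r := r t)
        (fun xh hxh => (hL1 G hω.1.1 hω.1.2.1 xh hxh).weaken (le_max_left _ _))
        (fun xh hxh ν hν eh heh =>
          (hL2 t G hω.1.1 hω.1.2.1 xh hxh ν hν eh heh).weaken (le_max_right _ _)) (ξ := ξstar ω)
        ?_ fun x hx e he => ?_)
      · rw [NNReal.coe_max]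
        linarith
      · exact hlt.trans_le ((hr t).symm.le.trans (hϰ (r t) x hx e he))
    · refine (Finset.sum_le_sum fun t _ => binTail_antitone (hε t).1 (hε t).2 (z + 4) hQ).trans ?_
      exact hN.1
  refine ⟨hfirst, fun hcrit => ?_⟩
  rw [ENNReal.ofReal_sub 1 hβ.1, ENNReal.ofReal_one, tsub_le_iff_right]
  rw [← measure_univ (μ := Measure.pi fun _ : Fin Q => P)]
  refine (measure_mono_ae ?_).trans ((measure_union_le _ _).trans (add_le_add le_rfl hfirst))
  filter_upwards [hcrit] with ω hω _
  by_cases hA : IsAPBF A (candidate g (Gstar ω).φ)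
  · exact Or.inl hA
  · exact Or.inr ⟨hω, hA⟩
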